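/- Fix real constants $c>0$, $t>0$, $\beta>0$ (independent of $r$), and write $\ell(x)=\log|\sinh x|$ (so $\ell(0)=-\infty$). For a probability measure $\mu$ on $\mathbb{R}$ and $\delta\ge 1$ let $$I_A(\mu)=\frac{c}{2t}\int x^2\,\mu(dx)-\frac{\beta}{2}\iint \ell(x-y)\,\mu(dx)\mu(dy),$$ $$I_C(\mu)=\frac{c}{2t}\int x^2\,\mu(dx)-\frac{\beta}{2}\iint \bigl(\ell(x-y)+\ell(x+y)\bigr)\mu(dx)\mu(dy),$$ $$I_{BC}(\mu)=\int \Bigl(\frac{c}{2t}x^2-\beta(\delta-1)\ell(x)\Bigr)\mu(dx)-\frac{\beta}{2}\iint \bigl(\ell(x-y)+\ell(x+y)\bigr)\mu(dx)\mu(dy),$$ where each functional is of the form $\int W\,d\mu-\frac{\beta}{2}\iint L\,d\mu\,d\mu$ and is understood as the single double integral $\iint\bigl(\tfrac12W(x)+\tfrac12W(y)-\tfrac{\beta}{2}L(x,y)\bigr)\mu(dx)\mu(dy)\in(-\infty,+\infty]$. Let $E_A=\inf_\mu I_A(\mu)$, $E_C=\inf_\mu I_C(\mu)$, $E_{BC}=\inf_\mu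 I_{BC}(\mu)$, the infima being over all probability measures $\mu$ on $\mathbb{R}$ ($E_{BC}$ depends on $\delta$). For $\sigma>0$ and real $\alpha,\gamma\ge 0$ let $$Z_{\mathfrak a}(\sigma)=\int_{\mathfrak a}e^{-\frac{c}{2\sigma^2}\sum_i a_i^2}\;P(a)\,da ,$$ where $\mathfrak a=\mathbb{R}^r$, except that $\mathfrak a=\{a\in\mathbb{R}^{r+1}:\sum_i a_i=0\}$ for $A_r$; where $da$ is $\kappa^r$ times the $r$-dimensional Lebesgue measure of $\mathfrak a$ for the Euclidean metric $\sum_i a_i^2$, with $\kappa>0$ an arbitrary constant independent of $r$ ($\kappa=1$ for Lebesgue measure itself, $\kappa=\sqrt c$ for the volume of the metric $c\sum_i a_i^2$); and where - $A_r$: $P(a)=\prod_{i<j}|\sinh(a_i-a_j)|^\beta$; - $B_r$: $P(a)=\prod_{i<j}|\sinh(a_i-a_j)\sinh(a_i+a_j)|^\beta\prod_i|\sinh a_i|^\alpha$; - $C_r$: $P(a)=\prod_{i<j}|\sinh(a_i-a_j)\sinh(a_i+a_j)|^\beta\prod_i|\sinh 2a_i|^\gamma$; - $D_r$: $P(a)=\prod_{i<j}|\sinh(a_i-a_j)\sinh(a_i+a_j)|^\beta$;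 - $(BC)_r$: $P(a)=\prod_{i<j}|\sinh(a_i-a_j)\sinh(a_i+a_j)|^\beta\prod_i|\sinh a_i|^\alpha|\sinh 2a_i|^\gamma$. Then $E_A$, $E_C$ and, for every $\delta\ge1$, $E_{BC}$ are finite. Moreover, when $r\to\infty$ while $t=r\sigma^2$ remains constant and $\gamma$ is fixed: - for $A_r$, $\lim \frac{1}{r^2}\log Z_{\mathfrak a}(\sigma)=-E_A$; - for $B_r$ with $\alpha=\beta(\delta-1)r$ for a constant $\delta\ge1$, $\lim \frac{1}{r^2}\log Z_{\mathfrak a}(\sigma)=-E_{BC}$; - for $C_r$ and for $D_r$, $\lim \frac{1}{r^2}\log Z_{\mathfrak a}(\sigma)=-E_C$; - for $(BC)_r$ with $\alpha=\beta(\delta-1)r$ for a constant $\delta\ge1$, $\lim \frac{1}{r^2}\log Z_{\mathfrak a}(\sigma)=-E_{BC}$; - for $(BC)_r$ with a fixed $\alpha\ge0$ independent of $r$ (in particular $\alpha=4$ or $\alpha=0$), $\lim \frac{1}{r^2}\log Z_{\mathfrak a}(\sigma)=-E_C$. -/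

import Mathlib

open MeasureTheory Filter Topology
open scoped ENNReal

namespace LogSinh

/-! ### Energy functionals -/

/-- `ℓ(x) = log |sinh x|`, with the value `-∞` at `x = 0`. -/
noncomputable def ell (x : ℝ) : EReal :=
  ENNReal.log (ENNReal.ofReal |Real.sinh x|)

/-- The integral `∫ f dμ = ∫ f⁺ dμ - ∫ f⁻ dμ` of an extended real valued function.  It is used
below for measurable functions that are bounded below, so that only the first term can be
infinite. -/
noncomputable def extIntegral {X : Type*} [MeasurableSpace X] (μ : Measure X) (f : X → EReal) :
    EReal :=
  ((∫⁻ x, (f x).toENNReal ∂μ : ℝ≥0∞) : EReal) - ((∫⁻ x, (-f x).toENNReal ∂μ : ℝ≥0∞) : EReal)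

/-- The energy `∫ W dμ - (β/2) ∫∫ L(x,y) μ(dx) μ(dy)` of a probability measure `μ` on `ℝ`.
Both terms are put under a single double integral, because each of them can be `+∞` for a measure
with infinite second moment.  For the potentials `W` and interactions `L` below, the integrand is
bounded below, so that the energy is a well-defined element of `(-∞, +∞]`; it coincides with the
difference of the two integrals as soon as `μ` has a finite second moment, and it is `+∞`
otherwise. -/
noncomputable def energy (β : ℝ) (W : ℝ → EReal) (L : ℝ → ℝ → EReal)
    (μ : ProbabilityMeasure ℝ) : EReal :=
  extIntegral ((μ : Measure ℝ).prod (μ : Measure ℝ)) fun p =>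
    ((1 / 2 : ℝ) : EReal) * W p.1 + ((1 / 2 : ℝ) : EReal) * W p.2
      - ((β / 2 : ℝ) : EReal) * L p.1 p.2

/-- `(c/2t) ∫ x² μ(dx) - (β/2) ∫∫ ℓ(x-y) μ(dx) μ(dy)`. -/
noncomputable def energyA (c t β : ℝ) (μ : ProbabilityMeasure ℝ) : EReal :=
  energy β (fun x => ((c / (2 * t) * x ^ 2 : ℝ) : EReal)) (fun x y => ell (x - y)) μ

/-- `(c/2t) ∫ x² μ(dx) - (β/2) ∫∫ (ℓ(x-y) + ℓ(x+y)) μ(dx) μ(dy)`. -/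
noncomputable def energyC (c t β : ℝ) (μ : ProbabilityMeasure ℝ) : EReal :=
  energy β (fun x => ((c / (2 * t) * x ^ 2 : ℝ) : EReal))
    (fun x y => ell (x - y) + ell (x + y)) μ

/-- `∫ ((c/2t) x² - β(δ-1) ℓ(x)) μ(dx) - (β/2) ∫∫ (ℓ(x-y) + ℓ(x+y)) μ(dx) μ(dy)`. -/
noncomputable def energyBC (c t β δ : ℝ) (μ : ProbabilityMeasure ℝ) : EReal :=
  energy β
    (fun x => ((c / (2 * t) * x ^ 2 : ℝ) : EReal) - ((β * (δ - 1) : ℝ) : EReal) * ell x)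
    (fun x y => ell (x - y) + ell (x + y)) μ

/-- The equilibrium energy `E_A`. -/
noncomputable def eqA (c t β : ℝ) : EReal := ⨅ μ : ProbabilityMeasure ℝ, energyA c t β μ

/-- The equilibrium energy `E_C`. -/
noncomputable def eqC (c t β : ℝ) : EReal := ⨅ μ : ProbabilityMeasure ℝ, energyC c t β μ

/-- The equilibrium energy `E_BC`. -/
noncomputable def eqBC (c t β δ : ℝ) : EReal := ⨅ μ : ProbabilityMeasure ℝ, energyBC c t β δ μ

/-! ### The integrals `Z_𝔞(σ)` -/

/-- `exp (-(c/2σ²) ∑ aᵢ²)`. -/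
noncomputable def gaussWeight (c σ : ℝ) {n : ℕ} (a : Fin n → ℝ) : ℝ :=
  Real.exp (-(c / (2 * σ ^ 2)) * ∑ i, a i ^ 2)

/-- `∏_{i<j} |sinh(aᵢ - aⱼ)|^β`. -/
noncomputable def prodMinus (β : ℝ) {n : ℕ} (a : Fin n → ℝ) : ℝ :=
  ∏ i, ∏ j ∈ Finset.Ioi i, |Real.sinh (a i - a j)| ^ β

/-- `∏_{i<j} |sinh(aᵢ - aⱼ) sinh(aᵢ + aⱼ)|^β`. -/
noncomputable def prodMinusPlus (β : ℝ) {n : ℕ} (a : Fin n → ℝ) : ℝ :=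
  ∏ i, ∏ j ∈ Finset.Ioi i, |Real.sinh (a i - a j) * Real.sinh (a i + a j)| ^ β

/-- The hyperplane `∑ aᵢ = 0` of Euclidean space `ℝ^{r+1}`. -/
noncomputable def hyperplane (r : ℕ) : Submodule ℝ (EuclideanSpace ℝ (Fin (r + 1))) where
  carrier := {a | ∑ i, a i = 0}
  add_mem' {a b} ha hb := by
    have ha' : ∑ i, a i = 0 := ha
    have hb' : ∑ i, b i = 0 := hb
    simp [Finset.sum_add_distrib, ha', hb']
  zero_mem' := by simp
  smul_mem' s a ha := by
    have ha' : ∑ i, a i = 0 := ha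
    simp [← Finset.mul_sum, ha']

/-- The `r`-dimensional Lebesgue measure on the hyperplane, for the Euclidean metric induced from
`ℝ^{r+1}` (a unit cube spanned by an orthonormal basis has measure one). -/
noncomputable def hyperplaneVolume (r : ℕ) : Measure (hyperplane r) :=
  (stdOrthonormalBasis ℝ (hyperplane r)).toBasis.addHaar

/-- `Z_𝔞(σ)` for the root system `A_r`.  In this and the following definitions, `da` is `κ^r` times
the Lebesgue measure of the `r`-dimensional space `𝔞`: this is Lebesgue measure in the
coordinates `aᵢ` if `κ = 1`, and the volume of the Riemannian metric `c ∑ daᵢ²` if `κ = √c`. -/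
noncomputable def ZA (κ c β : ℝ) (r : ℕ) (σ : ℝ) : ℝ≥0∞ :=
  ENNReal.ofReal (κ ^ r) *
    ∫⁻ a : hyperplane r, ENNReal.ofReal
      (gaussWeight c σ (fun i => a.1 i) * prodMinus β (fun i => a.1 i)) ∂(hyperplaneVolume r)

/-- `Z_𝔞(σ)` for the root system `B_r`. -/
noncomputable def ZB (κ c β α : ℝ) (r : ℕ) (σ : ℝ) : ℝ≥0∞ :=
  ENNReal.ofReal (κ ^ r) *
    ∫⁻ a : Fin r → ℝ, ENNReal.ofReal
      (gaussWeight c σ a * prodMinusPlus β a * ∏ i, |Real.sinh (a i)| ^ α)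

/-- `Z_𝔞(σ)` for the root system `C_r`. -/
noncomputable def ZC (κ c β γ : ℝ) (r : ℕ) (σ : ℝ) : ℝ≥0∞ :=
  ENNReal.ofReal (κ ^ r) *
    ∫⁻ a : Fin r → ℝ, ENNReal.ofReal
      (gaussWeight c σ a * prodMinusPlus β a * ∏ i, |Real.sinh (2 * a i)| ^ γ)

/-- `Z_𝔞(σ)` for the root system `D_r`. -/
noncomputable def ZD (κ c β : ℝ) (r : ℕ) (σ : ℝ) : ℝ≥0∞ :=
  ENNReal.ofReal (κ ^ r) *
    ∫⁻ a : Fin r → ℝ, ENNReal.ofReal (gaussWeight c σ a * prodMinusPlus β a)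

/-- `Z_𝔞(σ)` for the root system `(BC)_r`. -/
noncomputable def ZBC (κ c β α γ : ℝ) (r : ℕ) (σ : ℝ) : ℝ≥0∞ :=
  ENNReal.ofReal (κ ^ r) *
    ∫⁻ a : Fin r → ℝ, ENNReal.ofReal
      (gaussWeight c σ a * prodMinusPlus β a *
        ∏ i, |Real.sinh (a i)| ^ α * |Real.sinh (2 * a i)| ^ γ)

/-- `(1/r²) log Z`, with values in `[-∞, +∞]` (`log 0 = -∞`, `log ∞ = +∞`). -/
noncomputable def scaledLog (r : ℕ) (Z : ℝ≥0∞) : EReal :=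
  ((1 / (r : ℝ) ^ 2 : ℝ) : EReal) * ENNReal.log Z

end LogSinh

/-! This is the large-deviation argument for a log-gas at speed `r ^ 2`. The starting point is `log
|sinh x| = |x| - repulsion x`, where `repulsion` is a continuous function with values in `[0, ∞]`.
Confinement beats the linear terms, so after adding a constant (`Coupling.shift`) the two-body
energy becomes a continuous function `pairEnergy ≥ 0`. All energies are then lower Lebesgue
integrals of nonnegative functions, and no integrability question arises. The one-body terms of
strength of order `r` are shared out among the pairs, each variable lying in `n - 1` of them. Up to
an explicit factor, every integral is therefore exactly `∫ exp (-configEnergy a) ∏ w (a i) da`, with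
a one-body weight `w` independent of `r` (`weight_eq`, `ZBC_eq`, `ZA_eq`).

Upper bound: if `e` is below the minimal energy, every configuration of `n` points has energy at
least `e n ^ 2` for large `n` (`eventually_le_configEnergy_of_lt`). Otherwise empirical measures of
low energy would form a tight family, and a limit point would have energy at most `e`, by continuity
of the truncated energies; the truncated diagonal costs only `O(1/n)`. Keeping back a small fraction
of the energy as a Gaussian makes the remaining integral an `n`-th power, which is negligible on the
scale `n ^ 2` (`eventually_partitionFn_le`).

Lower bound: for a probability measure `ν` with density at most `C`, Lebesgue measure on `ℝ^n`
dominates `C^{-n} ν^{⊗n}`. Jensen's inequality for `exp (-·)` bounds the integral below by `exp (-n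
(n-1) totalEnergy ν - O(n))` (`le_partitionFn`). Such `ν` come arbitrarily close to the minimal
energy: convolving a measure with the uniform law on `[0, ε]` does not raise the energy in the limit
(`exists_smooth_totalEnergy_lt`). The domination needed there compares the logarithmic singularity
with `|x|^{-1/2}`, which is integrable and homogeneous.

For type A, the integrand on `ℝ^{r+1}` is the integrand on the hyperplane times a Gaussian in the
direction `(1, …, 1)`, because the product only involves differences. The resulting one-dimensional
factor is negligible. Types B, C and D are special cases of BC. -/

open scoped NNReal

namespace LogSinh

/-! ### The function `x ↦ e^{-x}` on `[0, ∞]` -/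

/-- `e^{-x}` for `x ∈ [0, ∞]`. -/
noncomputable def expNeg (x : ℝ≥0∞) : ℝ≥0∞ := EReal.exp (-(x : EReal))

lemma expNeg_add (x y : ℝ≥0∞) : expNeg (x + y) = expNeg x * expNeg y := by
  simp only [expNeg, EReal.exp_neg, EReal.coe_ennreal_add, EReal.exp_add]
  rw [ENNReal.mul_inv]
  · left; simp
  · right; simp

lemma expNeg_zero : expNeg 0 = 1 := by simp [expNeg]

lemma expNeg_top : expNeg ⊤ = 0 := by simp [expNeg]

lemma expNeg_ofReal {r : ℝ} (hr : 0 ≤ r) :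
    expNeg (ENNReal.ofReal r) = ENNReal.ofReal (Real.exp (-r)) := by
  rw [expNeg, EReal.coe_ennreal_ofReal, max_eq_left hr, ← EReal.coe_neg, EReal.exp_coe]

lemma expNeg_antitone : Antitone expNeg := fun x y h => by
  simpa [expNeg] using h

lemma measurable_expNeg : Measurable expNeg :=
  EReal.measurable_exp.comp (measurable_coe_ennreal_ereal.neg)

lemma expNeg_sum {ι : Type*} (s : Finset ι) (f : ι → ℝ≥0∞) :
    expNeg (∑ i ∈ s, f i) = ∏ i ∈ s, expNeg (f i) := by
  classical
  induction s using Finset.induction_on with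
  | empty => simp [expNeg_zero]
  | insert a s ha ih => rw [Finset.sum_insert ha, Finset.prod_insert ha, expNeg_add, ih]

/-- Jensen's inequality for `x ↦ e^{-x}`. -/
lemma expNeg_lintegral_le {X : Type*} [MeasurableSpace X] (P : Measure X) [IsProbabilityMeasure P]
    {S : X → ℝ≥0∞} (hS : Measurable S) : expNeg (∫⁻ x, S x ∂P) ≤ ∫⁻ x, expNeg (S x) ∂P := by
  by_cases hm : ∫⁻ x, S x ∂P = ⊤
  · simp [hm, expNeg_top]
  set m := (∫⁻ x, S x ∂P).toReal with hmdef
  have hm0 : 0 ≤ m := ENNReal.toReal_nonneg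
  have hI : ∫⁻ x, S x ∂P = ENNReal.ofReal m := (ENNReal.ofReal_toReal hm).symm
  -- Tangent line of `e^{-s}` at the mean `m`, with the negative term moved to the other side so
  -- that it makes sense in `[0, ∞]`.
  have key : ∀ x, ENNReal.ofReal (Real.exp (-m) * (1 + m)) ≤
      expNeg (S x) + ENNReal.ofReal (Real.exp (-m)) * S x := by
    intro x
    by_cases hx : S x = ⊤
    · have : ENNReal.ofReal (Real.exp (-m)) ≠ 0 := by simpa using Real.exp_pos _
      simp [hx, ENNReal.mul_top this]
    · obtain ⟨s, hs⟩ : ∃ s : ℝ≥0, S x = s := ⟨(S x).toNNReal, (ENNReal.coe_toNNReal hx).symm⟩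
      have hs' : S x = ENNReal.ofReal s := by rw [hs, ENNReal.ofReal_coe_nnreal]
      rw [hs', expNeg_ofReal s.coe_nonneg, ← ENNReal.ofReal_mul (Real.exp_pos _).le,
        ← ENNReal.ofReal_add (Real.exp_pos _).le (mul_nonneg (Real.exp_pos _).le s.coe_nonneg)]
      apply ENNReal.ofReal_le_ofReal
      have h1 : m - s + 1 ≤ Real.exp (m - s) := Real.add_one_le_exp _
      have h2 : Real.exp (-(s:ℝ)) = Real.exp (-m) * Real.exp (m - s) := by
        rw [← Real.exp_add]; ring_nf
      rw [h2]
      nlinarith [Real.exp_pos (-m)]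
  have h := lintegral_mono (μ := P) key
  rw [lintegral_const, measure_univ, mul_one, lintegral_add_left (f := fun x => expNeg (S x)) (measurable_expNeg.comp hS),
    lintegral_const_mul _ hS, hI, ← ENNReal.ofReal_mul (Real.exp_pos _).le, mul_add, mul_one,
    ENNReal.ofReal_add (Real.exp_pos _).le (by positivity)] at h
  rw [hI, expNeg_ofReal hm0]
  exact (ENNReal.add_le_add_iff_right ENNReal.ofReal_ne_top).1 h

/-! ### The repulsion `|x| - log |sinh x|` -/

/-- `e^{-|x|} |sinh x|`. -/
noncomputable def sinhRatio (x : ℝ) : ℝ := (1 - Real.exp (-(2 * |x|))) / 2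

lemma abs_sinh_eq (x : ℝ) : |Real.sinh x| = Real.exp |x| * sinhRatio x := by
  rw [Real.abs_sinh, Real.sinh_eq, sinhRatio]
  have : Real.exp (-(2 * |x|)) = Real.exp (-|x|) * Real.exp (-|x|) := by
    rw [← Real.exp_add]; ring_nf
  have h2 : Real.exp |x| * Real.exp (-|x|) = 1 := by rw [← Real.exp_add]; simp
  rw [this]
  linear_combination (Real.exp (-|x|) / 2) * h2

lemma sinhRatio_zero : sinhRatio 0 = 0 := by simp [sinhRatio]

lemma sinhRatio_pos {x : ℝ} (hx : x ≠ 0) : 0 < sinhRatio x := by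
  have : 0 < |x| := abs_pos.2 hx
  have : Real.exp (-(2 * |x|)) < 1 := by simpa using hx
  unfold sinhRatio; linarith

lemma sinhRatio_nonneg (x : ℝ) : 0 ≤ sinhRatio x := by
  rcases eq_or_ne x 0 with rfl | h
  · exact sinhRatio_zero.ge
  · exact (sinhRatio_pos h).le

lemma sinhRatio_lt_one (x : ℝ) : sinhRatio x < 1 := by
  unfold sinhRatio; linarith [Real.exp_pos (-(2 * |x|))]

lemma continuous_sinhRatio : Continuous sinhRatio := by
  unfold sinhRatio; fun_prop

/-- `|x| - log |sinh x| ∈ [0, ∞]`. -/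
noncomputable def repulsion (x : ℝ) : ℝ≥0∞ :=
  (-(ENNReal.log (ENNReal.ofReal (sinhRatio x)))).toENNReal

lemma continuous_repulsion : Continuous repulsion :=
  EReal.continuous_toENNReal.comp (continuous_neg.comp
    (ENNReal.continuous_log.comp (ENNReal.continuous_ofReal.comp continuous_sinhRatio)))

lemma repulsion_zero : repulsion 0 = ⊤ := by simp [repulsion, sinhRatio_zero]

lemma repulsion_of_ne {x : ℝ} (hx : x ≠ 0) :
    repulsion x = ENNReal.ofReal (-Real.log (sinhRatio x)) := by
  rw [repulsion, ENNReal.log_ofReal_of_pos (sinhRatio_pos hx), ← EReal.coe_neg,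
    EReal.real_coe_toENNReal]

lemma neg_log_sinhRatio_nonneg (x : ℝ) : 0 ≤ -Real.log (sinhRatio x) :=
  neg_nonneg.2 (Real.log_nonpos (sinhRatio_nonneg x) (sinhRatio_lt_one x).le)

lemma repulsion_neg (x : ℝ) : repulsion (-x) = repulsion x := by
  simp [repulsion, sinhRatio]

lemma ell_eq (x : ℝ) : ell x = ((|x| : ℝ) : EReal) - (repulsion x : EReal) := by
  rcases eq_or_ne x 0 with rfl | hx
  · simp [ell, repulsion_zero]
  · rw [ell, repulsion_of_ne hx, EReal.coe_ennreal_ofReal, max_eq_left (neg_log_sinhRatio_nonneg x),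
      abs_sinh_eq, ENNReal.log_ofReal_of_pos (mul_pos (Real.exp_pos _) (sinhRatio_pos hx)),
      Real.log_mul (Real.exp_pos _).ne' (sinhRatio_pos hx).ne', Real.log_exp, ← EReal.coe_sub]
    simp

lemma expNeg_mul_repulsion (q : ℝ≥0) (x : ℝ) :
    expNeg (q * repulsion x) = ENNReal.ofReal (sinhRatio x ^ (q : ℝ)) := by
  rcases eq_or_ne x 0 with rfl | hx
  · rcases eq_or_ne q 0 with rfl | hq
    · simp [expNeg_zero]
    · rw [repulsion_zero, ENNReal.mul_top (by simpa using hq), expNeg_top, sinhRatio_zero,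
        Real.zero_rpow (by simpa using hq), ENNReal.ofReal_zero]
  · rw [repulsion_of_ne hx, ← ENNReal.ofReal_coe_nnreal, ← ENNReal.ofReal_mul q.coe_nonneg,
      expNeg_ofReal (mul_nonneg q.coe_nonneg (neg_log_sinhRatio_nonneg x)),
      Real.rpow_def_of_pos (sinhRatio_pos hx)]
    congr 2; ring

lemma ofReal_abs_sinh_rpow (q : ℝ≥0) (x : ℝ) :
    ENNReal.ofReal (|Real.sinh x| ^ (q : ℝ)) =
      ENNReal.ofReal (Real.exp (q * |x|)) * expNeg (q * repulsion x) := by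
  rw [expNeg_mul_repulsion, ← ENNReal.ofReal_mul (Real.exp_pos _).le, abs_sinh_eq,
    Real.mul_rpow (Real.exp_pos _).le (sinhRatio_nonneg x), ← Real.exp_mul, mul_comm |x|]

/-! ### Domination of the logarithmic singularity by an integrable power -/

/-- `|x|^{-1/2} ∈ [0, ∞]`. -/
noncomputable def invSqrt (x : ℝ) : ℝ≥0∞ := ENNReal.ofReal |x| ^ (-(1 / 2) : ℝ)

lemma invSqrt_zero : invSqrt 0 = ⊤ := by
  simp [invSqrt]

lemma invSqrt_of_ne {x : ℝ} (hx : x ≠ 0) : invSqrt x = ENNReal.ofReal (√(1 / |x|)) := by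
  rw [invSqrt, ENNReal.ofReal_rpow_of_pos (abs_pos.2 hx), Real.rpow_neg (abs_nonneg x),
    ← Real.sqrt_eq_rpow, one_div, Real.sqrt_inv]

lemma measurable_invSqrt : Measurable invSqrt := by
  unfold invSqrt; fun_prop

lemma log_one_add_le {y : ℝ} (hy : 0 ≤ y) : Real.log (1 + y) ≤ 2 * √y := by
  have h0 := Real.sqrt_nonneg y
  have h1 : 1 + y ≤ (1 + √y) ^ 2 := by nlinarith [Real.sq_sqrt hy]
  have h2 : Real.log (1 + y) ≤ Real.log ((1 + √y) ^ 2) := Real.log_le_log (by linarith) h1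
  rw [Real.log_pow] at h2
  have h3 := Real.log_le_sub_one_of_pos (show 0 < 1 + √y by linarith)
  push_cast at h2; linarith

/-- From `e^{-2|x|} ≤ 1 / (1 + 2|x|)` one gets `sinhRatio x ≥ |x| / (1 + 2|x|)`. Taking logarithms,
this bounds `repulsion` above by a logarithm of `1/|x|`. -/
lemma one_le_sinhRatio_mul {x : ℝ} (hx : x ≠ 0) : 1 ≤ sinhRatio x * (2 + 1 / |x|) := by
  have hp : 0 < |x| := abs_pos.2 hx
  have h1 : 1 + 2 * |x| ≤ Real.exp (2 * |x|) := by linarith [Real.add_one_le_exp (2 * |x|)]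
  have h2 : Real.exp (-(2 * |x|)) ≤ 1 / (1 + 2 * |x|) := by
    rw [Real.exp_neg, one_div]
    exact inv_anti₀ (by linarith) h1
  have h3 : |x| / (1 + 2 * |x|) ≤ sinhRatio x := by
    unfold sinhRatio
    have : |x| / (1 + 2 * |x|) = (1 - 1 / (1 + 2 * |x|)) / 2 := by field_simp; ring
    linarith
  calc (1 : ℝ) = |x| / (1 + 2 * |x|) * (2 + 1 / |x|) := by field_simp; ring
    _ ≤ _ := by gcongr

lemma sinhRatio_le_add (x h : ℝ) : sinhRatio x ≤ sinhRatio (x + h) + |h| := by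
  have h1 : |x + h| ≤ |x| + |h| := abs_add_le x h
  have h2 : Real.exp (-(2 * |x + h|)) * (1 - 2 * |h|) ≤
      Real.exp (-(2 * |x + h|)) * Real.exp (-(2 * |h|)) := by
    gcongr; linarith [Real.add_one_le_exp (-(2 * |h|))]
  have h3 : Real.exp (-(2 * |x + h|)) ≤ 1 := Real.exp_le_one_iff.2 (by linarith [abs_nonneg (x + h)])
  have h4 : |x| ≤ |x + h| + |h| := by simpa using abs_sub (x + h) h
  have h5 : Real.exp (-(2 * |x + h|)) * Real.exp (-(2 * |h|)) ≤ Real.exp (-(2 * |x|)) := by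
    rw [← Real.exp_add]; apply Real.exp_le_exp.2; linarith
  unfold sinhRatio
  nlinarith [abs_nonneg h]

lemma repulsion_le (x : ℝ) : repulsion x ≤ 1 + 2 * invSqrt x := by
  rcases eq_or_ne x 0 with rfl | hx
  · simp [invSqrt_zero]
  have hp : 0 < |x| := abs_pos.2 hx
  have h1 := one_le_sinhRatio_mul hx
  have h2 := Real.log_nonneg h1
  rw [Real.log_mul (sinhRatio_pos hx).ne' (by positivity)] at h2
  have h3 : Real.log (2 + 1 / |x|) ≤ Real.log (2 * (1 + 1 / |x|)) :=
    Real.log_le_log (by positivity) (by have : 0 < 1 / |x| := by positivity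
                                        linarith)
  rw [Real.log_mul (by norm_num) (by positivity)] at h3
  have h4 := log_one_add_le (show 0 ≤ 1 / |x| by positivity)
  have h5 : Real.log 2 ≤ 1 := by linarith [Real.log_two_lt_d9]
  rw [repulsion_of_ne hx, invSqrt_of_ne hx]
  calc ENNReal.ofReal (-Real.log (sinhRatio x)) ≤ ENNReal.ofReal (1 + 2 * √(1 / |x|)) :=
        ENNReal.ofReal_le_ofReal (by linarith)
    _ = _ := by rw [ENNReal.ofReal_add (by norm_num) (by positivity), ENNReal.ofReal_mul (by norm_num)]
                simp

/-- Moving a point by `O(ε)` can create a singularity at `x + h`, but only one of size `log (1 + ε /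
|x + h|)`. The factor `√ε` is what makes the bound scale invariant: by `sqrt_mul_invSqrt` the last
term depends on `(x + h) / ε` only, so its average over displacements is bounded uniformly in `ε`.
-/
lemma repulsion_add_le (x : ℝ) {h ε : ℝ} (hε : 0 < ε) (hε1 : ε ≤ 1) (hh : |h| ≤ 2 * ε) :
    repulsion (x + h) ≤ repulsion x + (2 + 2 * (ENNReal.ofReal √ε * invSqrt (x + h))) := by
  have hε0 : ENNReal.ofReal √ε ≠ 0 := by simpa using hε
  rcases eq_or_ne (x + h) 0 with hy | hy
  · simp [hy, invSqrt_zero, ENNReal.mul_top hε0]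
  rcases eq_or_ne x 0 with rfl | hx
  · simp [repulsion_zero]
  have hp : 0 < |x + h| := abs_pos.2 hy
  have h1 := one_le_sinhRatio_mul hy
  have h2 := sinhRatio_le_add x h
  have h0 := sinhRatio_pos hy
  -- The Lipschitz bound gives the factor `1 + 2ε(2 + 1/|x+h|)`, and `1 + 4ε ≤ 5`.
  have h3 : sinhRatio x ≤ sinhRatio (x + h) * (5 * (1 + ε / |x + h|)) := by
    have : |h| ≤ 2 * ε * (sinhRatio (x + h) * (2 + 1 / |x + h|)) := by
      nlinarith
    have e : ε / |x + h| = ε * (1 / |x + h|) := by ring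
    have : 0 < 1 / |x + h| := by positivity
    rw [e]
    have : 0 < ε * (1 / |x + h|) := by positivity
    have h6 : sinhRatio (x + h) * ε ≤ sinhRatio (x + h) := by nlinarith
    have h7 : 0 < sinhRatio (x + h) * (ε * (1 / |x + h|)) := by positivity
    nlinarith
  have h4 := Real.log_le_log (sinhRatio_pos hx) h3
  rw [Real.log_mul h0.ne' (by positivity), Real.log_mul (by norm_num) (by positivity)] at h4
  have h5 := log_one_add_le (show 0 ≤ ε / |x + h| by positivity)
  have h6 : Real.log 5 ≤ 2 := by
    have : Real.log 5 ≤ Real.log (Real.exp 1 ^ 2) :=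
      Real.log_le_log (by norm_num) (by nlinarith [Real.exp_one_gt_d9])
    simpa using this
  have h7 : √(ε / |x + h|) = √ε * √(1 / |x + h|) := by
    rw [← Real.sqrt_mul hε.le]; congr 1; ring
  rw [repulsion_of_ne hx, repulsion_of_ne hy, invSqrt_of_ne hy, ← ENNReal.ofReal_mul (by positivity),
    ← h7]
  calc ENNReal.ofReal (-Real.log (sinhRatio (x + h)))
      ≤ ENNReal.ofReal (-Real.log (sinhRatio x) + (2 + 2 * √(ε / |x + h|))) :=
        ENNReal.ofReal_le_ofReal (by linarith)
    _ = _ := by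
        rw [ENNReal.ofReal_add (neg_log_sinhRatio_nonneg x) (by positivity),
          ENNReal.ofReal_add (by norm_num) (by positivity), ENNReal.ofReal_mul (by norm_num)]
        simp

/-- The restriction of `|x|^{-1/2}` to `[-1, 1]`. -/
noncomputable def invSqrtNear : ℝ → ℝ≥0∞ := (Set.Icc (-1) 1).indicator invSqrt

lemma measurable_invSqrtNear : Measurable invSqrtNear :=
  measurable_invSqrt.indicator measurableSet_Icc

lemma invSqrt_le (x : ℝ) : invSqrt x ≤ 1 + invSqrtNear x := by
  by_cases h : x ∈ Set.Icc (-1 : ℝ) 1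
  · rw [invSqrtNear, Set.indicator_of_mem h]; exact le_add_self
  · have h1 : 1 < |x| := by rw [Set.mem_Icc, ← abs_le] at h; exact not_le.1 h
    have h0 : x ≠ 0 := by rintro rfl; simp at h1; linarith
    rw [invSqrt_of_ne h0]
    refine le_trans ?_ le_self_add
    rw [ENNReal.ofReal_le_one, Real.sqrt_le_left (by norm_num), one_pow, div_le_one (by linarith)]
    exact h1.le

lemma lintegral_invSqrtNear_ne_top : ∫⁻ x, invSqrtNear x ≠ ⊤ := by
  have h1 : IntervalIntegrable (fun x : ℝ => x ^ (-(1 / 2) : ℝ)) volume 0 1 :=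
    intervalIntegral.intervalIntegrable_rpow' (by norm_num)
  rw [intervalIntegrable_iff_integrableOn_Icc_of_le zero_le_one] at h1
  have h2 : ∫⁻ x in Set.Icc (0 : ℝ) 1, invSqrt x ≠ ⊤ := by
    have h3 := h1.2
    rw [HasFiniteIntegral, ← restrict_Ioc_eq_restrict_Icc] at h3
    rw [← restrict_Ioc_eq_restrict_Icc]
    refine ne_of_lt (lt_of_eq_of_lt (setLIntegral_congr_fun measurableSet_Ioc fun x hx => ?_) h3)
    have hx0 : 0 < x := hx.1
    rw [invSqrt, abs_of_pos hx0, ENNReal.ofReal_rpow_of_pos hx0,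
      Real.enorm_of_nonneg (Real.rpow_nonneg hx0.le _)]
  have h3 : ∫⁻ x in Set.Icc (-1 : ℝ) 0, invSqrt x = ∫⁻ x in Set.Icc (0 : ℝ) 1, invSqrt x := by
    rw [← (Measure.measurePreserving_neg (volume : Measure ℝ)).setLIntegral_comp_preimage
      measurableSet_Icc measurable_invSqrt]
    simp [invSqrt]
  rw [invSqrtNear, lintegral_indicator measurableSet_Icc,
    ← Set.Icc_union_Icc_eq_Icc (show (-1 : ℝ) ≤ 0 by norm_num) zero_le_one]
  refine ne_top_of_le_ne_top ?_ (lintegral_union_le _ _ _)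
  rw [h3]
  exact ENNReal.add_ne_top.2 ⟨h2, h2⟩

/-! ### The two-body energy -/

/-- Parameters of the two-body weight
`e^{-2p(x² + y²)} |sinh (x - y)|^{2q} |sinh (x + y)|^{2q'} |sinh x sinh y|^{2s}`. -/
structure Coupling where
  /-- strength of the confinement -/
  p : ℝ
  p_pos : 0 < p
  /-- exponent of `|sinh (x - y)|` -/
  q : ℝ≥0
  /-- exponent of `|sinh (x + y)|` -/
  q' : ℝ≥0
  /-- exponent of `|sinh x sinh y|` -/
  s : ℝ≥0

namespace Coupling

variable (K : Coupling)

/-- The sum of the exponents. -/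
noncomputable def total : ℝ := K.q + K.q' + K.s

/-- The constant by which the two-body energy is shifted to become nonnegative. -/
noncomputable def shift : ℝ := K.total ^ 2 / K.p

/-- The regular part of the shifted two-body energy. -/
noncomputable def regular (x y : ℝ) : ℝ :=
  K.p * (x ^ 2 + y ^ 2) - K.q * |x - y| - K.q' * |x + y| - K.s * (|x| + |y|) + K.shift

/-- The shifted two-body energy. -/
noncomputable def pairEnergy (x y : ℝ) : ℝ≥0∞ :=
  ENNReal.ofReal (K.regular x y) + K.q * repulsion (x - y) + K.q' * repulsion (x + y)
    + K.s * (repulsion x + repulsion y)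

/-- The linear terms are at most `total * (|x| + |y|)`. Half of the confinement absorbs them by
completing the square, at the cost of `total ^ 2 / (2 p)` per variable; the shift is twice that. The
other half remains, and provides tightness and Gaussian decay. -/
lemma regular_ge (x y : ℝ) : K.p / 2 * (x ^ 2 + y ^ 2) ≤ K.regular x y := by
  have hp := K.p_pos
  have h1 : |x - y| ≤ |x| + |y| := abs_sub x y
  have h2 : |x + y| ≤ |x| + |y| := abs_add_le x y
  have h3 := mul_le_mul_of_nonneg_left h1 K.q.coe_nonneg
  have h4 := mul_le_mul_of_nonneg_left h2 K.q'.coe_nonneg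
  have key : ∀ z : ℝ, 0 ≤ K.p / 2 * z ^ 2 - K.total * |z| + K.total ^ 2 / (2 * K.p) := by
    intro z
    have : K.p / 2 * z ^ 2 - K.total * |z| + K.total ^ 2 / (2 * K.p) =
        K.p / 2 * (|z| - K.total / K.p) ^ 2 := by
      rw [← sq_abs z]; field_simp; ring
    rw [this]; positivity
  have kx := key x
  have ky := key y
  have hs : K.shift = K.total ^ 2 / (2 * K.p) + K.total ^ 2 / (2 * K.p) := by
    unfold shift; field_simp; ring
  unfold regular
  rw [hs]
  unfold total at *
  linarith

lemma regular_nonneg (x y : ℝ) : 0 ≤ K.regular x y :=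
  le_trans (by have := K.p_pos; positivity) (K.regular_ge x y)

lemma pairEnergy_comm (x y : ℝ) : K.pairEnergy x y = K.pairEnergy y x := by
  unfold pairEnergy regular
  rw [← repulsion_neg (x - y), neg_sub, add_comm y x, abs_sub_comm x y, add_comm (repulsion x),
    add_comm (x ^ 2), add_comm |x|]

lemma continuous_pairEnergy : Continuous fun z : ℝ × ℝ => K.pairEnergy z.1 z.2 := by
  have h : ∀ (a : ℝ≥0) {f : ℝ × ℝ → ℝ≥0∞}, Continuous f → Continuous fun z => (a : ℝ≥0∞) * f z :=
    fun a f hf => (ENNReal.continuous_const_mul ENNReal.coe_ne_top).comp hf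
  have hr : ∀ {f : ℝ × ℝ → ℝ}, Continuous f → Continuous fun z => repulsion (f z) :=
    fun hf => continuous_repulsion.comp hf
  unfold pairEnergy regular
  refine (((ENNReal.continuous_ofReal.comp (by fun_prop)).add (h _ (hr (by fun_prop)))).add
    (h _ (hr (by fun_prop)))).add (h _ ((hr (by fun_prop)).add (hr (by fun_prop))))

lemma measurable_pairEnergy : Measurable fun z : ℝ × ℝ => K.pairEnergy z.1 z.2 :=
  K.continuous_pairEnergy.measurable

lemma ofReal_sq_le_pairEnergy (x y : ℝ) :
    ENNReal.ofReal (K.p / 2 * (x ^ 2 + y ^ 2)) ≤ K.pairEnergy x y := by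
  unfold pairEnergy
  rw [add_assoc, add_assoc]
  exact (ENNReal.ofReal_le_ofReal (K.regular_ge x y)).trans le_self_add

lemma regular_add_le {x y h k : ℝ} (hh : |h| ≤ 1) (hk : |k| ≤ 1) :
    K.regular (x + h) (y + k) ≤
      K.regular x y + (K.p * (x ^ 2 + y ^ 2) + (4 * K.p + 2 * K.total)) := by
  have hp := K.p_pos
  have hs := abs_le.1 hh
  have ks := abs_le.1 hk
  have a1 : (x + h) ^ 2 ≤ 2 * x ^ 2 + 2 := by nlinarith [sq_nonneg (x - h)]
  have a2 : (y + k) ^ 2 ≤ 2 * y ^ 2 + 2 := by nlinarith [sq_nonneg (y - k)]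
  have sub : ∀ a d : ℝ, |a| ≤ |a + d| + |d| := fun a d => by
    simpa using abs_sub (a + d) d
  have b1 : |x - y| ≤ |x + h - (y + k)| + 2 := by
    have := sub (x - y) (h - k)
    have := abs_sub h k
    rw [show x + h - (y + k) = x - y + (h - k) by ring]; linarith
  have b2 : |x + y| ≤ |x + h + (y + k)| + 2 := by
    have := sub (x + y) (h + k)
    have := abs_add_le h k
    rw [show x + h + (y + k) = x + y + (h + k) by ring]; linarith
  have b3 := sub x h
  have b4 := sub y k
  have c1 := mul_le_mul_of_nonneg_left b1 K.q.coe_nonneg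
  have c2 := mul_le_mul_of_nonneg_left b2 K.q'.coe_nonneg
  have c3 := mul_le_mul_of_nonneg_left
    (show |x| + |y| ≤ |x + h| + |y + k| + 2 by linarith) K.s.coe_nonneg
  have c4 := mul_le_mul_of_nonneg_left (add_le_add a1 a2) hp.le
  unfold regular total
  linarith

/-- The singular terms that control the effect of a displacement on the energy. -/
noncomputable def singular (a b c d : ℝ) (z : ℝ × ℝ) : ℝ≥0∞ :=
  K.q * invSqrt (a + (z.1 - z.2)) + K.q' * invSqrt (b + (z.1 + z.2))
    + K.s * (invSqrt (c + z.1) + invSqrt (d + z.2))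

lemma measurable_singular (a b c d : ℝ) : Measurable (K.singular a b c d) := by
  have hr : ∀ {f : ℝ × ℝ → ℝ}, Measurable f → Measurable fun z => invSqrt (f z) :=
    fun hf => measurable_invSqrt.comp hf
  unfold singular
  exact (((hr (by fun_prop)).const_mul _).add ((hr (by fun_prop)).const_mul _)).add
    (((hr (by fun_prop)).add (hr (by fun_prop))).const_mul _)

lemma pairEnergy_le (x y : ℝ) :
    K.pairEnergy x y ≤ ENNReal.ofReal (K.regular x y) + (K.q + K.q' + K.s * 2)
      + 2 * K.singular 0 0 0 0 (x, y) := by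
  unfold pairEnergy singular
  calc _ ≤ ENNReal.ofReal (K.regular x y) + K.q * (1 + 2 * invSqrt (x - y))
        + K.q' * (1 + 2 * invSqrt (x + y))
        + K.s * ((1 + 2 * invSqrt x) + (1 + 2 * invSqrt y)) := by
        gcongr <;> exact repulsion_le _
    _ = _ := by simp only [zero_add]; ring

lemma sqrt_mul_invSqrt {ε : ℝ} (hε : 0 < ε) (x : ℝ) :
    ENNReal.ofReal √ε * invSqrt x = invSqrt (x / ε) := by
  rcases eq_or_ne x 0 with rfl | hx
  · have : ENNReal.ofReal √ε ≠ 0 := by simpa using hε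
    simp [invSqrt_zero, ENNReal.mul_top this]
  · rw [invSqrt_of_ne hx, invSqrt_of_ne (div_ne_zero hx hε.ne'), ← ENNReal.ofReal_mul (by positivity),
      ← Real.sqrt_mul hε.le, abs_div, abs_of_pos hε]
    congr 2; field_simp

/-- The regular part can grow by a multiple of `x ^ 2 + y ^ 2`, which is itself bounded by the
energy; this accounts for the factor `3`. The repulsive parts are handled by `repulsion_add_le`, in
rescaled variables. -/
lemma pairEnergy_add_le {ε : ℝ} (hε : 0 < ε) (hε1 : ε ≤ 1) (x y : ℝ) {u v : ℝ}
    (hu : u ∈ Set.Icc (0 : ℝ) 1) (hv : v ∈ Set.Icc (0 : ℝ) 1) :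
    K.pairEnergy (x + ε * u) (y + ε * v) ≤ 3 * K.pairEnergy x y
      + (ENNReal.ofReal (4 * K.p + 2 * K.total) + 2 * (K.q + K.q' + K.s * 2))
      + 2 * K.singular ((x - y) / ε) ((x + y) / ε) (x / ε) (y / ε) (u, v) := by
  have hp := K.p_pos
  have hT : 0 ≤ K.total := by unfold total; positivity
  have hu' : |ε * u| ≤ ε := by
    rw [abs_mul, abs_of_pos hε, abs_of_nonneg hu.1]; nlinarith [hu.2]
  have hv' : |ε * v| ≤ ε := by
    rw [abs_mul, abs_of_pos hε, abs_of_nonneg hv.1]; nlinarith [hv.2]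
  have r0 : ENNReal.ofReal (K.regular (x + ε * u) (y + ε * v)) ≤
      ENNReal.ofReal (K.regular x y) + (2 * K.pairEnergy x y
        + ENNReal.ofReal (4 * K.p + 2 * K.total)) := by
    calc _ ≤ ENNReal.ofReal (K.regular x y + (2 * (K.p / 2 * (x ^ 2 + y ^ 2))
            + (4 * K.p + 2 * K.total))) := by
          apply ENNReal.ofReal_le_ofReal
          have := K.regular_add_le (x := x) (y := y) (hu'.trans hε1) (hv'.trans hε1)
          linarith
      _ = ENNReal.ofReal (K.regular x y) + (2 * ENNReal.ofReal (K.p / 2 * (x ^ 2 + y ^ 2))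
            + ENNReal.ofReal (4 * K.p + 2 * K.total)) := by
          rw [ENNReal.ofReal_add (K.regular_nonneg x y) (by positivity),
            ENNReal.ofReal_add (by positivity) (by positivity), ENNReal.ofReal_mul (by norm_num)]
          simp
      _ ≤ _ := by gcongr; exact K.ofReal_sq_le_pairEnergy x y
  have rep : ∀ a h : ℝ, |ε * h| ≤ 2 * ε →
      repulsion (a + ε * h) ≤ repulsion a + (2 + 2 * invSqrt (a / ε + h)) := by
    intro a h hh
    have := repulsion_add_le a hε hε1 hh
    rwa [sqrt_mul_invSqrt hε, show (a + ε * h) / ε = a / ε + h by field_simp] at this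
  have r1 := rep (x - y) (u - v) (by
    rw [mul_sub]; have := abs_sub (ε * u) (ε * v); linarith)
  have r2 := rep (x + y) (u + v) (by
    rw [mul_add]; have := abs_add_le (ε * u) (ε * v); linarith)
  have r3 := rep x u (by linarith)
  have r4 := rep y v (by linarith)
  rw [show x - y + ε * (u - v) = x + ε * u - (y + ε * v) by ring] at r1
  rw [show x + y + ε * (u + v) = x + ε * u + (y + ε * v) by ring] at r2
  calc K.pairEnergy (x + ε * u) (y + ε * v)
      ≤ (ENNReal.ofReal (K.regular x y) + (2 * K.pairEnergy x y
        + ENNReal.ofReal (4 * K.p + 2 * K.total)))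
        + K.q * (repulsion (x - y) + (2 + 2 * invSqrt ((x - y) / ε + (u - v))))
        + K.q' * (repulsion (x + y) + (2 + 2 * invSqrt ((x + y) / ε + (u + v))))
        + K.s * ((repulsion x + (2 + 2 * invSqrt (x / ε + u)))
          + (repulsion y + (2 + 2 * invSqrt (y / ε + v)))) := by
        rw [pairEnergy]; gcongr
    _ = (2 * K.pairEnergy x y + (ENNReal.ofReal (K.regular x y) + K.q * repulsion (x - y)
          + K.q' * repulsion (x + y) + K.s * (repulsion x + repulsion y)))
        + (ENNReal.ofReal (4 * K.p + 2 * K.total) + 2 * (K.q + K.q' + K.s * 2))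
        + 2 * (K.q * invSqrt ((x - y) / ε + (u - v)) + K.q' * invSqrt ((x + y) / ε + (u + v))
          + K.s * (invSqrt (x / ε + u) + invSqrt (y / ε + v))) := by ring
    _ = _ := by
        rw [show (3 : ℝ≥0∞) = 2 + 1 by norm_num, add_mul, one_mul]; rfl

end Coupling

/-! ### Smearing a measure -/

/-- The uniform distribution on `[0, 1]`. -/
noncomputable def unif : Measure ℝ := volume.restrict (Set.Icc 0 1)

instance : IsProbabilityMeasure unif := ⟨by simp [unif]⟩

/-- A bound for the integral of `|x|^{-1/2}` over an interval of length one. -/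
noncomputable def invSqrtBound : ℝ≥0∞ := 1 + ∫⁻ x, invSqrtNear x

lemma invSqrtBound_ne_top : invSqrtBound ≠ ⊤ :=
  ENNReal.add_ne_top.2 ⟨ENNReal.one_ne_top, lintegral_invSqrtNear_ne_top⟩

lemma lintegral_invSqrt_add_le (a : ℝ) : ∫⁻ u, invSqrt (a + u) ∂unif ≤ invSqrtBound := by
  calc ∫⁻ u, invSqrt (a + u) ∂unif ≤ ∫⁻ u, (1 + invSqrtNear (a + u)) ∂unif :=
        lintegral_mono fun u => invSqrt_le _
    _ = 1 + ∫⁻ u, invSqrtNear (a + u) ∂unif := by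
        rw [lintegral_add_left measurable_const]; simp
    _ ≤ 1 + ∫⁻ u, invSqrtNear (a + u) := by
        gcongr; exact Measure.restrict_le_self
    _ = invSqrtBound := by rw [lintegral_add_left_eq_self (fun u => invSqrtNear u) a]; rfl

namespace Coupling

variable (K : Coupling)

/-- Each singular term is a translate of `invSqrt` in one of the two variables when the other is
frozen, so the bound does not depend on `a b c d`. -/
lemma lintegral_singular_le (a b c d : ℝ) :
    ∫⁻ z, K.singular a b c d z ∂(unif.prod unif) ≤
      (K.q + K.q' + K.s * 2) * invSqrtBound := by
  have m1 : Measurable fun z : ℝ × ℝ => invSqrt (a + (z.1 - z.2)) :=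
    measurable_invSqrt.comp (by fun_prop)
  have m2 : Measurable fun z : ℝ × ℝ => invSqrt (b + (z.1 + z.2)) :=
    measurable_invSqrt.comp (by fun_prop)
  have m3 : Measurable fun z : ℝ × ℝ => invSqrt (c + z.1) := measurable_invSqrt.comp (by fun_prop)
  have m4 : Measurable fun z : ℝ × ℝ => invSqrt (d + z.2) := measurable_invSqrt.comp (by fun_prop)
  have bd : ∀ f : ℝ × ℝ → ℝ≥0∞, Measurable f →
      (∀ v, ∃ e, ∀ u, f (u, v) = invSqrt (e + u)) →
      ∫⁻ z, f z ∂(unif.prod unif) ≤ invSqrtBound := by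
    intro f hf h
    rw [lintegral_prod_symm _ hf.aemeasurable]
    calc _ ≤ ∫⁻ _, invSqrtBound ∂unif := lintegral_mono fun v => by
          obtain ⟨e, he⟩ := h v
          simp only [he]
          exact lintegral_invSqrt_add_le e
      _ = _ := by simp
  have i1 := bd _ m1 fun v => ⟨a - v, fun u => by congr 1; ring⟩
  have i2 := bd _ m2 fun v => ⟨b + v, fun u => by congr 1; ring⟩
  have i3 := bd _ m3 fun v => ⟨c, fun u => rfl⟩
  have i4 : ∫⁻ z, invSqrt (d + z.2) ∂(unif.prod unif) ≤ invSqrtBound := by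
    rw [lintegral_prod _ m4.aemeasurable]
    calc _ ≤ ∫⁻ _, invSqrtBound ∂unif := lintegral_mono fun v => lintegral_invSqrt_add_le d
      _ = _ := by simp
  have m34 : Measurable fun z : ℝ × ℝ => invSqrt (c + z.1) + invSqrt (d + z.2) := m3.add m4
  unfold singular
  rw [lintegral_add_right _ (m34.const_mul _), lintegral_add_left (m1.const_mul _),
    lintegral_const_mul _ m1, lintegral_const_mul _ m2, lintegral_const_mul _ m34,
    lintegral_add_left m3]
  calc _ ≤ K.q * invSqrtBound + K.q' * invSqrtBound + K.s * (invSqrtBound + invSqrtBound) := by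
        gcongr
    _ = _ := by ring

/-- The shifted energy of a measure. -/
noncomputable def totalEnergy (μ : Measure ℝ) : ℝ≥0∞ :=
  ∫⁻ z, K.pairEnergy z.1 z.2 ∂(μ.prod μ)

/-- A single measure of finite energy, which makes the minimal energy finite. -/
lemma totalEnergy_unif_ne_top : K.totalEnergy unif ≠ ⊤ := by
  have hC : (K.q + K.q' + K.s * 2 : ℝ≥0∞) ≠ ⊤ := by finiteness
  have hle : ∀ᵐ z ∂(unif.prod unif), K.pairEnergy z.1 z.2 ≤
      (ENNReal.ofReal (2 * K.p + K.shift) + (K.q + K.q' + K.s * 2))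
        + 2 * K.singular 0 0 0 0 z := by
    have hmem : ∀ᵐ z ∂(unif.prod unif), z ∈ Set.Icc (0 : ℝ) 1 ×ˢ Set.Icc (0 : ℝ) 1 := by
      rw [unif, Measure.prod_restrict]
      exact ae_restrict_mem (measurableSet_Icc.prod measurableSet_Icc)
    filter_upwards [hmem] with z hz
    refine (K.pairEnergy_le z.1 z.2).trans ?_
    gcongr
    have hp := K.p_pos
    have h1 : z.1 ^ 2 ≤ 1 := by nlinarith [hz.1.1, hz.1.2]
    have h2 : z.2 ^ 2 ≤ 1 := by nlinarith [hz.2.1, hz.2.2]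
    have := mul_nonneg K.q.coe_nonneg (abs_nonneg (z.1 - z.2))
    have := mul_nonneg K.q'.coe_nonneg (abs_nonneg (z.1 + z.2))
    have := mul_nonneg K.s.coe_nonneg (add_nonneg (abs_nonneg z.1) (abs_nonneg z.2))
    unfold regular
    nlinarith
  refine ne_top_of_le_ne_top ?_ (lintegral_mono_ae hle)
  rw [lintegral_add_left measurable_const, lintegral_const, measure_univ, mul_one,
    lintegral_const_mul _ (K.measurable_singular _ _ _ _)]
  have h := K.lintegral_singular_le 0 0 0 0
  have h' : ∫⁻ z, K.singular 0 0 0 0 z ∂(unif.prod unif) ≠ ⊤ :=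
    ne_top_of_le_ne_top (ENNReal.mul_ne_top hC invSqrtBound_ne_top) h
  finiteness

end Coupling

/-- The distribution of `x + ε u` for independent `x` and `u` with distribution `μ` and the uniform
distribution on `[0, 1]`. -/
noncomputable def smear (μ : Measure ℝ) (ε : ℝ) : Measure ℝ :=
  (μ.prod unif).map fun z => z.1 + ε * z.2

instance (μ : Measure ℝ) [IsProbabilityMeasure μ] (ε : ℝ) : IsProbabilityMeasure (smear μ ε) :=
  Measure.isProbabilityMeasure_map (by fun_prop)

lemma smear_le (μ : Measure ℝ) [IsProbabilityMeasure μ] {ε : ℝ} (hε : 0 < ε) :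
    smear μ ε ≤ ENNReal.ofReal ε⁻¹ • volume := by
  refine Measure.le_iff.2 fun A hA => ?_
  have hm : Measurable fun z : ℝ × ℝ => z.1 + ε * z.2 := by fun_prop
  rw [smear, Measure.map_apply hm hA, Measure.prod_apply (hm hA)]
  calc _ ≤ ∫⁻ _, ENNReal.ofReal ε⁻¹ * volume A ∂μ := lintegral_mono fun x => by
        refine (Measure.restrict_le_self _).trans ?_
        have : (Prod.mk x ⁻¹' ((fun z : ℝ × ℝ => z.1 + ε * z.2) ⁻¹' A)) =
            (fun u => ε * u) ⁻¹' ((fun y => x + y) ⁻¹' A) := rfl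
        rw [this, Real.volume_preimage_mul_left hε.ne', measure_preimage_add,
          abs_of_pos (inv_pos.2 hε)]
    _ = _ := by simp

lemma lintegral_smear_prod (μ : Measure ℝ) [IsProbabilityMeasure μ] (ε : ℝ) {f : ℝ × ℝ → ℝ≥0∞}
    (hf : Measurable f) :
    ∫⁻ z, f z ∂((smear μ ε).prod (smear μ ε)) =
      ∫⁻ x, ∫⁻ u, f (x.1 + ε * u.1, x.2 + ε * u.2) ∂(unif.prod unif) ∂(μ.prod μ) := by
  have hm : Measurable fun z : ℝ × ℝ => z.1 + ε * z.2 := by fun_prop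
  have h1 : ∀ x u : ℝ, Measurable fun b : ℝ × ℝ => f (x + ε * u, b.1 + ε * b.2) := fun x u =>
    hf.comp (by fun_prop)
  have h2 : Measurable fun w : (ℝ × ℝ) × (ℝ × ℝ) => f (w.1.1 + ε * w.1.2, w.2.1 + ε * w.2.2) :=
    hf.comp (by fun_prop)
  have h3 : Measurable fun w : (ℝ × ℝ) × (ℝ × ℝ) => f (w.1.1 + ε * w.2.1, w.1.2 + ε * w.2.2) :=
    hf.comp (by fun_prop)
  have h4 : ∀ x : ℝ, Measurable fun w : (ℝ × ℝ) × ℝ => f (x + ε * w.1.1, w.1.2 + ε * w.2) := fun x =>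
    hf.comp (by fun_prop)
  have h5 : ∀ x y : ℝ, Measurable fun w : ℝ × ℝ => f (x + ε * w.1, y + ε * w.2) := fun x y =>
    hf.comp (by fun_prop)
  rw [smear, Measure.map_prod_map _ _ hm hm, lintegral_map hf (by fun_prop)]
  calc _ = ∫⁻ x, ∫⁻ u, ∫⁻ y, ∫⁻ v, f (x + ε * u, y + ε * v) ∂unif ∂μ ∂unif ∂μ := by
        refine (lintegral_prod _ h2.aemeasurable).trans
          ((lintegral_prod _ h2.lintegral_prod_right'.aemeasurable).trans ?_)
        refine lintegral_congr fun x => lintegral_congr fun u => ?_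
        exact lintegral_prod _ (h1 x u).aemeasurable
    _ = ∫⁻ x, ∫⁻ y, ∫⁻ u, ∫⁻ v, f (x + ε * u, y + ε * v) ∂unif ∂unif ∂μ ∂μ :=
        lintegral_congr fun x => lintegral_lintegral_swap (h4 x).lintegral_prod_right'.aemeasurable
    _ = _ := by
        rw [lintegral_prod _ h3.lintegral_prod_right'.aemeasurable]
        refine lintegral_congr fun x => lintegral_congr fun y => ?_
        exact (lintegral_prod _ (h5 x y).aemeasurable).symm

namespace Coupling

variable (K : Coupling)

lemma lintegral_pairEnergy_add_le {ε : ℝ} (hε : 0 < ε) (hε1 : ε ≤ 1) (x y : ℝ) :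
    ∫⁻ u, K.pairEnergy (x + ε * u.1) (y + ε * u.2) ∂(unif.prod unif) ≤
      3 * K.pairEnergy x y +
        (ENNReal.ofReal (4 * K.p + 2 * K.total) + 2 * (K.q + K.q' + K.s * 2)
          + 2 * ((K.q + K.q' + K.s * 2) * invSqrtBound)) := by
  have hmem : ∀ᵐ z ∂(unif.prod unif), z ∈ Set.Icc (0 : ℝ) 1 ×ˢ Set.Icc (0 : ℝ) 1 := by
    rw [unif, Measure.prod_restrict]
    exact ae_restrict_mem (measurableSet_Icc.prod measurableSet_Icc)
  refine (lintegral_mono_ae (hmem.mono fun u hu =>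
    K.pairEnergy_add_le hε hε1 x y hu.1 hu.2)).trans ?_
  rw [lintegral_add_left measurable_const, lintegral_const, measure_univ, mul_one,
    lintegral_const_mul _ (K.measurable_singular _ _ _ _), add_assoc]
  gcongr
  exact K.lintegral_singular_le _ _ _ _

/-- Only upper semicontinuity at `(x, y)` is used; at points of infinite energy there is nothing to
prove. -/
lemma limsup_lintegral_pairEnergy_le (x y : ℝ) {ε : ℕ → ℝ} (hε : ∀ n, 0 < ε n)
    (hlim : Tendsto ε atTop (𝓝 0)) :
    limsup (fun n => ∫⁻ u, K.pairEnergy (x + ε n * u.1) (y + ε n * u.2) ∂(unif.prod unif)) atTop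
      ≤ K.pairEnergy x y := by
  refine le_of_forall_gt fun c hc => ?_
  obtain ⟨c', hc', hc'c⟩ := exists_between hc
  refine lt_of_le_of_lt ?_ hc'c
  have hopen : ∀ᶠ z : ℝ × ℝ in 𝓝 (x, y), K.pairEnergy z.1 z.2 < c' :=
    (K.continuous_pairEnergy.tendsto (x, y)).eventually_lt_const hc'
  obtain ⟨r, hr, hball⟩ := Metric.eventually_nhds_iff.1 hopen
  have hmem : ∀ᵐ z ∂(unif.prod unif), z ∈ Set.Icc (0 : ℝ) 1 ×ˢ Set.Icc (0 : ℝ) 1 := by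
    rw [unif, Measure.prod_restrict]
    exact ae_restrict_mem (measurableSet_Icc.prod measurableSet_Icc)
  refine limsup_le_of_le (by isBoundedDefault) ?_
  filter_upwards [hlim.eventually_lt_const hr] with n hn
  calc _ ≤ ∫⁻ _, c' ∂(unif.prod unif) := by
        refine lintegral_mono_ae (hmem.mono fun u hu => ?_)
        refine le_of_lt (hball (y := (x + ε n * u.1, y + ε n * u.2)) ?_)
        have h1 : ∀ w ∈ Set.Icc (0 : ℝ) 1, |ε n * w| < r := fun w hw => by
          rw [abs_mul, abs_of_pos (hε n), abs_of_nonneg hw.1]; nlinarith [hw.2, hε n]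
        simp only [Prod.dist_eq, Real.dist_eq, add_sub_cancel_left]
        exact max_lt (h1 _ hu.1) (h1 _ hu.2)
    _ = c' := by simp

/-- A measure can be approximated in energy by measures with a bounded density. -/
lemma exists_smooth_totalEnergy_lt (μ : Measure ℝ) [IsProbabilityMeasure μ] {e : ℝ≥0∞}
    (he : K.totalEnergy μ < e) :
    ∃ ν : Measure ℝ, ∃ C : ℝ, IsProbabilityMeasure ν ∧ 0 < C ∧ ν ≤ ENNReal.ofReal C • volume ∧
      K.totalEnergy ν < e := by
  set ε : ℕ → ℝ := fun n => 1 / ((n : ℝ) + 1) with hεdef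
  have hε : ∀ n, 0 < ε n := fun n => by positivity
  have hε1 : ∀ n, ε n ≤ 1 := fun n => by
    simp only [hεdef]; rw [div_le_one (by positivity)]; simp
  have hlim : Tendsto ε atTop (𝓝 0) := tendsto_one_div_add_atTop_nhds_zero_nat
  have hm : ∀ n, Measurable fun w : (ℝ × ℝ) × (ℝ × ℝ) =>
      K.pairEnergy (w.1.1 + ε n * w.2.1) (w.1.2 + ε n * w.2.2) := fun n =>
    K.measurable_pairEnergy.comp (f := fun w : (ℝ × ℝ) × (ℝ × ℝ) =>
      (w.1.1 + ε n * w.2.1, w.1.2 + ε n * w.2.2)) (by fun_prop)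
  have hfin : K.totalEnergy μ ≠ ⊤ := (he.trans_le le_top).ne
  have key : limsup (fun n => K.totalEnergy (smear μ (ε n))) atTop ≤ K.totalEnergy μ := by
    have e1 : (fun n => K.totalEnergy (smear μ (ε n))) = fun n =>
        ∫⁻ x, ∫⁻ u, K.pairEnergy (x.1 + ε n * u.1) (x.2 + ε n * u.2) ∂(unif.prod unif)
          ∂(μ.prod μ) :=
      funext fun n => lintegral_smear_prod μ (ε n) K.measurable_pairEnergy
    rw [e1]
    -- Reverse Fatou lemma, with the dominating function `3 * pairEnergy + const`. Its integral is
    -- finite because `μ` has finite energy.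
    refine (limsup_lintegral_le _ (fun n => (hm n).lintegral_prod_right') (fun n => ae_of_all _ fun x =>
      K.lintegral_pairEnergy_add_le (hε n) (hε1 n) x.1 x.2) ?_).trans
      (lintegral_mono fun x => K.limsup_lintegral_pairEnergy_le x.1 x.2 hε hlim)
    rw [lintegral_add_right _ measurable_const, lintegral_const_mul _ K.measurable_pairEnergy,
      lintegral_const, measure_univ, mul_one]
    have := invSqrtBound_ne_top
    refine ENNReal.add_ne_top.2 ⟨ENNReal.mul_ne_top (by norm_num) hfin, by finiteness⟩
  obtain ⟨n, hn⟩ := (eventually_lt_of_limsup_lt (key.trans_lt he)).exists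
  exact ⟨smear μ (ε n), (ε n)⁻¹, inferInstance, inv_pos.2 (hε n), smear_le μ (hε n), hn⟩

end Coupling

/-! ### Empirical measures -/

/-- The empirical measure of a configuration. -/
noncomputable def empirical {n : ℕ} (a : Fin n → ℝ) : Measure ℝ :=
  (n : ℝ≥0∞)⁻¹ • ∑ i, Measure.dirac (a i)

lemma lintegral_empirical {n : ℕ} (a : Fin n → ℝ) {f : ℝ → ℝ≥0∞} (hf : Measurable f) :
    ∫⁻ x, f x ∂(empirical a) = (n : ℝ≥0∞)⁻¹ * ∑ i, f (a i) := by
  simp [empirical, lintegral_smul_measure, lintegral_finsetSum_measure, lintegral_dirac' _ hf]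

lemma isProbabilityMeasure_empirical {n : ℕ} (hn : n ≠ 0) (a : Fin n → ℝ) :
    IsProbabilityMeasure (empirical a) := by
  constructor
  rw [← lintegral_one, lintegral_empirical a measurable_const]
  simpa using ENNReal.inv_mul_cancel (by simpa using hn) (ENNReal.natCast_ne_top n)

lemma lintegral_empirical_prod {n : ℕ} (hn : n ≠ 0) (a : Fin n → ℝ) {f : ℝ × ℝ → ℝ≥0∞}
    (hf : Measurable f) :
    ∫⁻ z, f z ∂((empirical a).prod (empirical a)) =
      (n : ℝ≥0∞)⁻¹ * ((n : ℝ≥0∞)⁻¹ * ∑ i, ∑ j, f (a i, a j)) := by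
  have := isProbabilityMeasure_empirical hn a
  rw [lintegral_prod _ hf.aemeasurable, lintegral_empirical a hf.lintegral_prod_right']
  have h : ∀ x, ∫⁻ y, f (x, y) ∂(empirical a) = (n : ℝ≥0∞)⁻¹ * ∑ j, f (x, a j) := fun x =>
    lintegral_empirical a (hf.comp measurable_prodMk_left)
  simp_rw [h, Finset.mul_sum]

lemma sum_sum_eq_of_symm {n : ℕ} {M : Type*} [AddCommMonoid M] (f : Fin n → Fin n → M)
    (hf : ∀ i j, f i j = f j i) :
    ∑ i, ∑ j, f i j = ∑ i, f i i + ∑ i, ∑ j ∈ Finset.Ioi i, (f i j + f i j) := by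
  have h := Finset.sum_sum_Ioi_add_eq_sum_sum_off_diag f
  calc ∑ i, ∑ j, f i j = ∑ i, (f i i + ∑ j ∈ {i}ᶜ, f j i) :=
        Finset.sum_congr rfl fun i _ => by
          rw [Fintype.sum_eq_add_sum_compl i]
          exact congrArg _ (Finset.sum_congr rfl fun j _ => hf i j)
    _ = _ := by
        rw [Finset.sum_add_distrib, ← h]
        refine congrArg _ (Finset.sum_congr rfl fun i _ => Finset.sum_congr rfl fun j _ => ?_)
        rw [hf j i]

lemma sum_Ioi_add {n : ℕ} {M : Type*} [AddCommMonoid M] (f : Fin n → M) :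
    ∑ i, ∑ j ∈ Finset.Ioi i, (f i + f j) = ∑ i, (n - 1) • f i := by
  have h := Finset.sum_sum_Ioi_add_eq_sum_sum_off_diag fun _ j : Fin n => f j
  rw [h]
  refine Finset.sum_congr rfl fun i _ => ?_
  rw [Finset.sum_const, Finset.card_compl, Finset.card_singleton, Fintype.card_fin]

/-! ### A lower bound for the energy of a configuration -/

namespace Coupling

variable (K : Coupling)

/-- The shifted energy of a configuration. -/
noncomputable def configEnergy {n : ℕ} (a : Fin n → ℝ) : ℝ≥0∞ :=
  ∑ i, ∑ j ∈ Finset.Ioi i, (K.pairEnergy (a i) (a j) + K.pairEnergy (a i) (a j))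

/-- The minimal shifted energy of a probability measure. -/
noncomputable def minEnergy : ℝ≥0∞ := ⨅ μ : ProbabilityMeasure ℝ, K.totalEnergy (μ : Measure ℝ)

lemma minEnergy_ne_top : K.minEnergy ≠ ⊤ :=
  ne_top_of_le_ne_top K.totalEnergy_unif_ne_top
    (iInf_le (fun μ : ProbabilityMeasure ℝ => K.totalEnergy (μ : Measure ℝ)) ⟨unif, inferInstance⟩)

/-- Each variable belongs to `n - 1` pairs, and each pair is counted twice in `configEnergy`, which
compensates for the factor `p / 2`. -/
lemma sum_sq_le_configEnergy {n : ℕ} (a : Fin n → ℝ) :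
    (n - 1 : ℕ) * ∑ i, ENNReal.ofReal (K.p * a i ^ 2) ≤ K.configEnergy a := by
  have hp := K.p_pos
  have h := sum_Ioi_add fun i => ENNReal.ofReal (K.p * a i ^ 2)
  simp only [nsmul_eq_mul, ← Finset.mul_sum] at h
  rw [← h, configEnergy]
  refine Finset.sum_le_sum fun i _ => Finset.sum_le_sum fun j _ => ?_
  refine le_trans (le_of_eq ?_) (add_le_add (K.ofReal_sq_le_pairEnergy _ _)
    (K.ofReal_sq_le_pairEnergy _ _))
  rw [← ENNReal.ofReal_add (by positivity) (by positivity),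
    ← ENNReal.ofReal_add (by positivity) (by positivity)]
  congr 1; ring

/-- The truncated two-body energy. -/
noncomputable def truncated (M : ℕ) : BoundedContinuousFunction (ℝ × ℝ) ℝ≥0 :=
  BoundedContinuousFunction.mkOfBound
    ⟨fun z => (min (K.pairEnergy z.1 z.2) M).toNNReal, by
      rw [continuous_iff_continuousAt]
      intro z
      refine ContinuousAt.comp (g := ENNReal.toNNReal) (ENNReal.tendsto_toNNReal ?_)
        (K.continuous_pairEnergy.min continuous_const).continuousAt
      exact ne_top_of_le_ne_top (ENNReal.natCast_ne_top M) (min_le_right _ _)⟩ M (by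
    intro z w
    have h : ∀ z : ℝ × ℝ, (min (K.pairEnergy z.1 z.2) M).toNNReal ≤ (M : ℝ≥0) := fun z =>
      by
      simpa using ENNReal.toNNReal_mono (ENNReal.natCast_ne_top M) (min_le_right (K.pairEnergy z.1 z.2) M)
    have h1 := NNReal.coe_le_coe.2 (h z)
    have h2 := NNReal.coe_le_coe.2 (h w)
    simp only [ContinuousMap.coe_mk, NNReal.dist_eq]
    rw [abs_le]
    constructor <;> linarith [NNReal.coe_nonneg (min (K.pairEnergy z.1 z.2) M).toNNReal,
      NNReal.coe_nonneg (min (K.pairEnergy w.1 w.2) M).toNNReal, NNReal.coe_natCast M])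

lemma coe_truncated (M : ℕ) (z : ℝ × ℝ) :
    (K.truncated M z : ℝ≥0∞) = min (K.pairEnergy z.1 z.2) M :=
  ENNReal.coe_toNNReal (ne_top_of_le_ne_top (ENNReal.natCast_ne_top M) (min_le_right _ _))

lemma measurable_coe_truncated (M : ℕ) : Measurable fun z => (K.truncated M z : ℝ≥0∞) := by
  simp only [coe_truncated]
  exact K.measurable_pairEnergy.min measurable_const

/-- Monotone convergence. Each truncation is bounded and continuous, hence passes to weak limits;
the energy is therefore lower semicontinuous. -/
lemma totalEnergy_eq_iSup (μ : Measure ℝ) :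
    K.totalEnergy μ = ⨆ M : ℕ, ∫⁻ z, K.truncated M z ∂(μ.prod μ) := by
  rw [← lintegral_iSup (fun M => K.measurable_coe_truncated M)]
  · refine lintegral_congr fun z => ?_
    simp only [coe_truncated]
    rw [← inf_iSup_eq, ENNReal.iSup_natCast, inf_top_eq]
  · intro M M' h z
    simp only [coe_truncated]
    gcongr

/-- The energy of an empirical measure itself may be infinite because of the diagonal; after
truncation the `n` diagonal terms contribute at most `n * M`, which is negligible against `n ^ 2`.
-/
lemma lintegral_truncated_empirical_le {n : ℕ} (hn : n ≠ 0) (a : Fin n → ℝ) (M : ℕ) :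
    ∫⁻ z, K.truncated M z ∂((empirical a).prod (empirical a)) ≤
      (n : ℝ≥0∞)⁻¹ * ((n : ℝ≥0∞)⁻¹ * (n * M + K.configEnergy a)) := by
  rw [lintegral_empirical_prod hn a (K.measurable_coe_truncated M),
    sum_sum_eq_of_symm (fun i j => (K.truncated M (a i, a j) : ℝ≥0∞))
      (fun i j => by simp only [coe_truncated, K.pairEnergy_comm])]
  simp only [coe_truncated]
  gcongr
  · calc _ ≤ ∑ _i : Fin n, (M : ℝ≥0∞) := Finset.sum_le_sum fun i _ => min_le_right _ _
      _ = _ := by simp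
  · refine Finset.sum_le_sum fun i _ => Finset.sum_le_sum fun j _ => ?_
    gcongr <;> exact min_le_left _ _

/-! ### Compactness and the lower bound for configurations -/

/-- The probability measures whose mass outside of `[-m, m]` is at most `C / m`, for all `m ≥ 1`. -/
def tightSet (C : ℝ≥0) : Set (ProbabilityMeasure ℝ) :=
  {μ | ∀ m : ℕ, μ (Set.Icc (-((m : ℝ) + 1)) ((m : ℝ) + 1))ᶜ ≤ C * (1 / ((m : ℝ≥0) + 1))}

lemma isCompact_tightSet (C : ℝ≥0) : IsCompact (tightSet C) := by
  refine isCompact_setOfPred_probabilityMeasure_mass_eq_compl_isCompact_le ?_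
    (fun m => isCompact_Icc) (Or.inl inferInstance)
  have : Tendsto (fun m : ℕ => C * (1 / ((m : ℝ≥0) + 1))) atTop (𝓝 (C * 0)) :=
    tendsto_const_nhds.mul tendsto_one_div_add_atTop_nhds_zero_nat
  simpa using this

/-- Markov's inequality, with `x ^ 2 ≥ (m + 1) ^ 2 ≥ m + 1` outside the interval. -/
lemma mem_tightSet {μ : ProbabilityMeasure ℝ} {C : ℝ≥0} {p : ℝ} (hp : 0 < p)
    (h : ∫⁻ x, ENNReal.ofReal (p * x ^ 2) ∂(μ : Measure ℝ) ≤ C) :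
    μ ∈ tightSet (C / p.toNNReal) := by
  intro m
  rw [← ENNReal.coe_le_coe, ProbabilityMeasure.ennreal_coeFn_eq_coeFn_toMeasure]
  have hsub : (Set.Icc (-((m : ℝ) + 1)) ((m : ℝ) + 1))ᶜ ⊆
      {x | ENNReal.ofReal (p * ((m : ℝ) + 1)) ≤ ENNReal.ofReal (p * x ^ 2)} := by
    intro x hx
    apply ENNReal.ofReal_le_ofReal
    rw [Set.mem_compl_iff, Set.mem_Icc, ← abs_le, not_le] at hx
    have : (m : ℝ) + 1 ≤ x ^ 2 := by
      rw [← sq_abs]; nlinarith [(Nat.cast_nonneg m : (0 : ℝ) ≤ m)]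
    gcongr
  refine (measure_mono hsub).trans ((meas_ge_le_lintegral_div (by fun_prop) ?_ ?_).trans ?_)
  · simp only [ne_eq, ENNReal.ofReal_eq_zero, not_le]; positivity
  · exact ENNReal.ofReal_ne_top
  · refine (ENNReal.div_le_div_right h _).trans (le_of_eq ?_)
    have e : ENNReal.ofReal (p * ((m : ℝ) + 1)) = ((p.toNNReal * ((m : ℝ≥0) + 1) : ℝ≥0) : ℝ≥0∞) := by
      rw [ENNReal.ofReal, Real.toNNReal_mul hp.le, Real.toNNReal_add (by positivity) zero_le_one]
      simp
    have hp' : p.toNNReal ≠ 0 := by simpa using hp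
    rw [e, ← ENNReal.coe_div (by positivity)]
    congr 1; field_simp

lemma eventually_le_configEnergy_of_lt {e : ℝ≥0} (he : (e : ℝ≥0∞) < K.minEnergy) :
    ∀ᶠ n : ℕ in atTop, ∀ a : Fin n → ℝ, (e : ℝ≥0∞) * n ^ 2 ≤ K.configEnergy a := by
  by_contra hcon
  rw [not_eventually] at hcon
  obtain ⟨φ, hφ, hP⟩ := extraction_of_frequently_atTop (hcon.and_eventually (eventually_ge_atTop 2))
  have h2 : ∀ k, 2 ≤ φ k := fun k => (hP k).2
  have hP1 : ∀ k, ∃ a : Fin (φ k) → ℝ, K.configEnergy a < (e : ℝ≥0∞) * (φ k : ℝ≥0∞) ^ 2 :=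
    fun k => by simpa only [not_forall, not_le] using (hP k).1
  choose a ha using hP1
  have hne : ∀ k, φ k ≠ 0 := fun k => by have := h2 k; omega
  have hinv : ∀ k (x : ℝ≥0∞), (φ k : ℝ≥0∞)⁻¹ * (φ k * x) = x := fun k x => by
    rw [← mul_assoc, ENNReal.inv_mul_cancel (by simpa using hne k) (ENNReal.natCast_ne_top _),
      one_mul]
  let μ : ℕ → ProbabilityMeasure ℝ := fun k =>
    ⟨empirical (a k), isProbabilityMeasure_empirical (hne k) (a k)⟩
  have hmom : ∀ k, ∫⁻ x, ENNReal.ofReal (K.p * x ^ 2) ∂(μ k : Measure ℝ) ≤ (2 * e : ℝ≥0) := by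
    intro k
    change ∫⁻ x, ENNReal.ofReal (K.p * x ^ 2) ∂(empirical (a k)) ≤ _
    rw [lintegral_empirical _ (by fun_prop)]
    set T := ∑ i, ENNReal.ofReal (K.p * a k i ^ 2)
    have h1 : ((φ k - 1 : ℕ) : ℝ≥0∞) * T ≤ e * (φ k : ℝ≥0∞) ^ 2 :=
      (K.sum_sq_le_configEnergy (a k)).trans (ha k).le
    -- This is where at least two points are needed: the confinement is carried by pairs.
    have h3 : (φ k : ℝ≥0∞) ≤ 2 * ((φ k - 1 : ℕ) : ℝ≥0∞) := by
      have := h2 k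
      exact_mod_cast (by omega : φ k ≤ 2 * (φ k - 1))
    have h4 : (φ k : ℝ≥0∞) * T ≤ φ k * (φ k * (2 * e)) := by
      calc (φ k : ℝ≥0∞) * T ≤ 2 * ((φ k - 1 : ℕ) : ℝ≥0∞) * T := by gcongr
        _ = 2 * (((φ k - 1 : ℕ) : ℝ≥0∞) * T) := by ring
        _ ≤ 2 * (e * (φ k : ℝ≥0∞) ^ 2) := by gcongr
        _ = _ := by ring
    have h5 : T ≤ φ k * (2 * e) := by
      have := mul_le_mul_right h4 ((φ k : ℝ≥0∞)⁻¹)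
      rwa [hinv, hinv] at this
    calc _ ≤ (φ k : ℝ≥0∞)⁻¹ * (φ k * (2 * e)) := by gcongr
      _ = _ := by rw [hinv]; simp
  have hmem : ∀ k, μ k ∈ tightSet (2 * e / K.p.toNNReal) := fun k => mem_tightSet K.p_pos (hmom k)
  -- A limit along a non-principal ultrafilter replaces the extraction of a further convergent
  -- subsequence.
  obtain ⟨ν, -, hν⟩ := (isCompact_tightSet (2 * e / K.p.toNNReal)).ultrafilter_le_nhds
    ((hyperfilter ℕ).map μ) (by
      rw [le_principal_iff]
      exact Filter.univ_mem' (f := (hyperfilter ℕ : Filter ℕ)) hmem)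
  have hν' : Tendsto μ (hyperfilter ℕ : Filter ℕ) (𝓝 ν) := hν
  have hprod : Tendsto (fun k => (μ k).prod (μ k)) (hyperfilter ℕ : Filter ℕ) (𝓝 (ν.prod ν)) :=
    (ProbabilityMeasure.continuous_prod.tendsto (ν, ν)).comp (hν'.prodMk_nhds hν')
  rw [ProbabilityMeasure.tendsto_iff_forall_lintegral_tendsto] at hprod
  have hfinal : K.totalEnergy (ν : Measure ℝ) ≤ e := by
    rw [totalEnergy_eq_iSup]
    refine iSup_le fun M => ?_
    have hR : Tendsto (fun k => (M : ℝ≥0∞) * (φ k : ℝ≥0∞)⁻¹ + e) (hyperfilter ℕ : Filter ℕ)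
        (𝓝 ((M : ℝ≥0∞) * 0 + e)) := by
      refine Tendsto.add (ENNReal.Tendsto.const_mul ?_ (Or.inr (ENNReal.natCast_ne_top M)))
        tendsto_const_nhds
      exact (ENNReal.tendsto_inv_nat_nhds_zero.comp hφ.tendsto_atTop).mono_left
        Nat.hyperfilter_le_atTop
    rw [mul_zero, zero_add] at hR
    refine le_of_tendsto_of_tendsto' (hprod (K.truncated M)) hR fun k => ?_
    refine (K.lintegral_truncated_empirical_le (hne k) (a k) M).trans ?_
    calc _ ≤ (φ k : ℝ≥0∞)⁻¹ * ((φ k : ℝ≥0∞)⁻¹ * (φ k * M + φ k * (φ k * e))) := by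
          gcongr
          exact (ha k).le.trans (le_of_eq (by ring))
      _ = _ := by rw [← mul_add, hinv, mul_add, hinv, mul_comm]
  exact absurd (he.trans_le (iInf_le _ ν)) (not_lt.2 hfinal)

lemma eventually_le_configEnergy {e : ℝ} (he : e < K.minEnergy.toReal) :
    ∀ᶠ n : ℕ in atTop, ∀ a : Fin n → ℝ, ENNReal.ofReal (e * n ^ 2) ≤ K.configEnergy a := by
  rcases le_or_gt e 0 with h0 | h0
  · refine Eventually.of_forall fun n a => ?_
    rw [ENNReal.ofReal_of_nonpos (mul_nonpos_of_nonpos_of_nonneg h0 (by positivity))]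
    exact zero_le
  · have h1 : ((e.toNNReal : ℝ≥0) : ℝ≥0∞) < K.minEnergy :=
      (ENNReal.ofReal_lt_iff_lt_toReal h0.le K.minEnergy_ne_top).2 he
    filter_upwards [K.eventually_le_configEnergy_of_lt h1] with n hn a
    refine le_trans (le_of_eq ?_) (hn a)
    rw [ENNReal.ofReal_mul h0.le, ENNReal.ofReal_pow (by positivity), ENNReal.ofReal_natCast]
    rfl

end Coupling

/-! ### Product measures -/

lemma lintegral_pi_prod_eq_pow (μ : Measure ℝ) [SigmaFinite μ] {f : ℝ → ℝ≥0∞} (hf : Measurable f)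
    (n : ℕ) :
    ∫⁻ a : Fin n → ℝ, ∏ i, f (a i) ∂(Measure.pi fun _ => μ) = (∫⁻ x, f x ∂μ) ^ n := by
  induction n with
  | zero => simp
  | succ n ih =>
    have hm : Measurable fun a : Fin n → ℝ => ∏ i, f (a i) :=
      Finset.measurable_prod _ fun i _ => hf.comp (measurable_pi_apply i)
    have h := measurePreserving_piFinSuccAbove (fun _ : Fin (n + 1) => μ) 0
    calc _ = ∫⁻ a : Fin (n + 1) → ℝ,
          (fun z : ℝ × (Fin n → ℝ) => f z.1 * ∏ i, f (z.2 i))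
            (MeasurableEquiv.piFinSuccAbove (fun _ => ℝ) 0 a) ∂(Measure.pi fun _ => μ) := by
          refine lintegral_congr fun a => ?_
          simp [Fin.prod_univ_succ, MeasurableEquiv.piFinSuccAbove, Fin.tail]
      _ = ∫⁻ z, f z.1 * ∏ i, f (z.2 i) ∂(μ.prod (Measure.pi fun _ => μ)) :=
          h.lintegral_comp ((hf.comp measurable_fst).mul (hm.comp measurable_snd))
      _ = _ := by
          rw [lintegral_prod_mul hf.aemeasurable hm.aemeasurable, ih, pow_succ']

/-- The product outer measure is the largest one bounded by the product of the sides on boxes, so it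
is enough to compare on boxes. -/
lemma pi_mono_measure {ν μ : Measure ℝ} [SigmaFinite ν] (h : ν ≤ μ) (n : ℕ) :
    (Measure.pi fun _ : Fin n => ν) ≤ Measure.pi fun _ : Fin n => μ := by
  have ho : (Measure.pi fun _ : Fin n => ν).toOuterMeasure ≤
      OuterMeasure.pi fun _ : Fin n => μ.toOuterMeasure := by
    refine OuterMeasure.le_pi.2 fun s _ => ?_
    rw [Measure.coe_toOuterMeasure, Measure.pi_pi]
    exact Finset.prod_le_prod' fun i _ => h (s i)
  refine Measure.le_iff.2 fun s hs => ?_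
  rw [Measure.pi_def (fun _ : Fin n => μ), toMeasure_apply _ _ hs]
  exact ho s

lemma pi_le_of_le_smul {ν μ : Measure ℝ} [SigmaFinite ν] [SigmaFinite μ] {c : ℝ≥0}
    (h : ν ≤ (c : ℝ≥0∞) • μ) (n : ℕ) :
    (Measure.pi fun _ : Fin n => ν) ≤ (c : ℝ≥0∞) ^ n • Measure.pi fun _ : Fin n => μ := by
  have : SigmaFinite ((c : ℝ≥0∞) • μ) := inferInstanceAs (SigmaFinite (c • μ))
  refine (pi_mono_measure h n).trans (le_of_eq (Measure.pi_eq fun s _ => ?_))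
  simp [Measure.pi_pi, Finset.prod_mul_distrib]

lemma lintegral_pi_pair {ν : Measure ℝ} [IsProbabilityMeasure ν] {n : ℕ} {i j : Fin n} (hij : i ≠ j)
    {f : ℝ × ℝ → ℝ≥0∞} (hf : Measurable f) :
    ∫⁻ a : Fin n → ℝ, f (a i, a j) ∂(Measure.pi fun _ => ν) = ∫⁻ z, f z ∂(ν.prod ν) := by
  have hind := (ProbabilityTheory.iIndepFun_pi (μ := fun _ : Fin n => ν) (X := fun _ x => x)
    fun _ => aemeasurable_id).indepFun hij
  rw [ProbabilityTheory.indepFun_iff_map_prod_eq_prod_map_map (measurable_pi_apply i).aemeasurable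
    (measurable_pi_apply j).aemeasurable] at hind
  have he : ∀ k : Fin n, (Measure.pi fun _ : Fin n => ν).map (fun a => a k) = ν := fun k =>
    (measurePreserving_eval (fun _ : Fin n => ν) k).map_eq
  rw [he, he] at hind
  rw [← hind, lintegral_map hf (by fun_prop)]

/-! ### Asymptotics of the partition function -/

/-- The one-body weight `e^{-m x²} |sinh x|^α |sinh 2x|^γ`. -/
noncomputable def oneBody (m α γ : ℝ≥0) (x : ℝ) : ℝ≥0∞ :=
  ENNReal.ofReal (Real.exp (-(m * x ^ 2)) * |Real.sinh x| ^ (α : ℝ) * |Real.sinh (2 * x)| ^ (γ : ℝ))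

lemma measurable_oneBody (m α γ : ℝ≥0) : Measurable (oneBody m α γ) := by
  unfold oneBody
  have := Real.continuous_sinh.measurable
  fun_prop

lemma oneBody_eq (m α γ : ℝ≥0) (x : ℝ) :
    oneBody m α γ x = ENNReal.ofReal (Real.exp (-(m * x ^ 2))) *
      (ENNReal.ofReal (Real.exp (α * |x|)) * expNeg (α * repulsion x)) *
      (ENNReal.ofReal (Real.exp (γ * |2 * x|)) * expNeg (γ * repulsion (2 * x))) := by
  rw [← ofReal_abs_sinh_rpow, ← ofReal_abs_sinh_rpow, ← ENNReal.ofReal_mul (by positivity),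
    ← ENNReal.ofReal_mul (by positivity), oneBody]

lemma expNeg_le_one (x : ℝ≥0∞) : expNeg x ≤ 1 := by
  rw [← expNeg_zero]; exact expNeg_antitone zero_le

/-- The weight grows at most like `exp ((α + 2γ)|x|)`, and half of the Gaussian absorbs this. Since
`m = 0` is allowed, the extra Gaussian is indispensable. -/
lemma lintegral_oneBody_mul_gaussian_ne_top (m α γ : ℝ≥0) {τ : ℝ} (hτ : 0 < τ) :
    ∫⁻ x, oneBody m α γ x * ENNReal.ofReal (Real.exp (-(τ * x ^ 2))) ≠ ⊤ := by
  set L : ℝ := α + 2 * γ with hL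
  have hbound : ∀ x : ℝ, oneBody m α γ x * ENNReal.ofReal (Real.exp (-(τ * x ^ 2))) ≤
      ENNReal.ofReal (Real.exp (L ^ 2 / (2 * τ)) * Real.exp (-(τ / 2) * x ^ 2)) := by
    intro x
    calc _ ≤ ENNReal.ofReal (Real.exp (-(m * x ^ 2))) * (ENNReal.ofReal (Real.exp (α * |x|)) * 1) *
          (ENNReal.ofReal (Real.exp (γ * |2 * x|)) * 1) * ENNReal.ofReal (Real.exp (-(τ * x ^ 2))) := by
          rw [oneBody_eq]; gcongr <;> exact expNeg_le_one _
      _ ≤ _ := by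
          rw [mul_one, mul_one, ← ENNReal.ofReal_mul (Real.exp_pos _).le,
            ← ENNReal.ofReal_mul (by positivity), ← ENNReal.ofReal_mul (by positivity),
            ← Real.exp_add, ← Real.exp_add, ← Real.exp_add, ← Real.exp_add]
          apply ENNReal.ofReal_le_ofReal
          apply Real.exp_le_exp.2
          have h1 : L ^ 2 / (2 * τ) + -(τ / 2) * x ^ 2 - (L * |x| - τ * x ^ 2) =
              τ / 2 * (|x| - L / τ) ^ 2 := by
            rw [← sq_abs x]; field_simp; ring
          have h2 : 0 ≤ τ / 2 * (|x| - L / τ) ^ 2 := by positivity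
          have h3 : 0 ≤ (m : ℝ) * x ^ 2 := by positivity
          rw [abs_mul, abs_two]
          have h4 : L * |x| = α * |x| + γ * (2 * |x|) := by rw [hL]; ring
          linarith
  have hint : Integrable fun x : ℝ => Real.exp (L ^ 2 / (2 * τ)) * Real.exp (-(τ / 2) * x ^ 2) :=
    (integrable_exp_neg_mul_sq (by positivity)).const_mul _
  refine ne_top_of_le_ne_top ?_ (lintegral_mono hbound)
  rw [← ofReal_integral_eq_lintegral_ofReal hint (ae_of_all _ fun x => by positivity)]
  exact ENNReal.ofReal_ne_top

/-- A nonnegative upper bound for `-log (e^{-m x²} |sinh x|^α |sinh 2x|^γ)`. -/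
noncomputable def oneBodyCost (m α γ : ℝ≥0) (x : ℝ) : ℝ≥0∞ :=
  ENNReal.ofReal (m * x ^ 2) + α * repulsion x + γ * repulsion (2 * x)

lemma measurable_oneBodyCost (m α γ : ℝ≥0) : Measurable (oneBodyCost m α γ) := by
  unfold oneBodyCost
  have := continuous_repulsion.measurable
  exact (Measurable.add (by fun_prop) (this.const_mul _)).add
    ((this.comp (measurable_const_mul 2)).const_mul _)

/-- The factors `e^{α|x|}` and `e^{γ|2x|}` are at least one and can be dropped in a lower bound. -/
lemma expNeg_oneBodyCost_le (m α γ : ℝ≥0) (x : ℝ) :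
    expNeg (oneBodyCost m α γ x) ≤ oneBody m α γ x := by
  have h1 : ∀ y : ℝ, 0 ≤ y → 1 ≤ ENNReal.ofReal (Real.exp y) := fun y hy => by
    simpa using hy
  rw [oneBodyCost, expNeg_add, expNeg_add, expNeg_ofReal (by positivity), oneBody_eq]
  gcongr
  · exact le_mul_of_one_le_left' (h1 _ (by positivity))
  · exact le_mul_of_one_le_left' (h1 _ (by positivity))

lemma lintegral_repulsion_le {ν : Measure ℝ} [IsProbabilityMeasure ν] {C : ℝ}
    (hν : ν ≤ ENNReal.ofReal C • volume) (b : ℝ) (hb : 1 ≤ b) :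
    ∫⁻ x, repulsion (b * x) ∂ν ≤ 3 + 2 * (ENNReal.ofReal C * ∫⁻ x, invSqrtNear x) := by
  have hle : ∀ x, repulsion (b * x) ≤ 3 + 2 * invSqrtNear x := fun x => by
    rcases eq_or_ne x 0 with rfl | hx
    · simp [invSqrtNear, invSqrt_zero]
    · have hmono : invSqrt (b * x) ≤ invSqrt x := by
        rw [invSqrt_of_ne hx, invSqrt_of_ne (mul_ne_zero (by linarith) hx)]
        apply ENNReal.ofReal_le_ofReal
        apply Real.sqrt_le_sqrt
        have : 0 < |x| := abs_pos.2 hx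
        rw [abs_mul, abs_of_pos (by linarith : 0 < b)]
        gcongr
        nlinarith
      calc _ ≤ 1 + 2 * invSqrt (b * x) := repulsion_le _
        _ ≤ 1 + 2 * (1 + invSqrtNear x) := by gcongr; exact hmono.trans (invSqrt_le x)
        _ = _ := by ring
  calc _ ≤ ∫⁻ x, (3 + 2 * invSqrtNear x) ∂ν := lintegral_mono hle
    _ = 3 + 2 * ∫⁻ x, invSqrtNear x ∂ν := by
        rw [lintegral_add_left measurable_const, lintegral_const_mul _ measurable_invSqrtNear]
        simp
    _ ≤ 3 + 2 * ∫⁻ x, invSqrtNear x ∂(ENNReal.ofReal C • volume) := by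
        gcongr
    _ = _ := by rw [lintegral_smul_measure]; rfl

lemma eventually_mul_le_mul_sq (c : ℝ) {d : ℝ} (hd : 0 < d) :
    ∀ᶠ n : ℕ in atTop, c * n ≤ d * (n : ℝ) ^ 2 := by
  filter_upwards [eventually_ge_atTop ⌈c / d⌉₊] with n hn
  have h1 : c / d ≤ n := Nat.ceil_le.1 hn
  rw [div_le_iff₀ hd] at h1
  nlinarith [(Nat.cast_nonneg n : (0 : ℝ) ≤ n)]

namespace Coupling

variable (K : Coupling)

/-- The shifted partition function. -/
noncomputable def partitionFn (w : ℝ → ℝ≥0∞) (n : ℕ) : ℝ≥0∞ :=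
  ∫⁻ a : Fin n → ℝ, expNeg (K.configEnergy a) * ∏ i, w (a i)

lemma measurable_configEnergy (n : ℕ) : Measurable fun a : Fin n → ℝ => K.configEnergy a := by
  unfold configEnergy
  refine Finset.measurable_sum _ fun i _ => Finset.measurable_sum _ fun j _ => ?_
  have : Measurable fun a : Fin n → ℝ => K.pairEnergy (a i) (a j) :=
    K.measurable_pairEnergy.comp (f := fun a : Fin n → ℝ => (a i, a j)) (by fun_prop)
  exact this.add this

/-! ### Upper bound for the partition function -/

lemma expNeg_ofReal_le (r : ℝ) : expNeg (ENNReal.ofReal r) ≤ ENNReal.ofReal (Real.exp (-r)) := by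
  rcases le_total 0 r with h | h
  · exact (expNeg_ofReal h).le
  · rw [ENNReal.ofReal_of_nonpos h, expNeg_zero]
    simpa using h

lemma expNeg_configEnergy_le {n : ℕ} (hn : 2 ≤ n) {e θ : ℝ} (hθ : 0 < θ) (hθ1 : θ < 1)
    {a : Fin n → ℝ} (ha : ENNReal.ofReal (e * n ^ 2) ≤ K.configEnergy a) :
    expNeg (K.configEnergy a) ≤ ENNReal.ofReal (Real.exp (-((1 - θ) * (e * n ^ 2)))) *
      ∏ i, ENNReal.ofReal (Real.exp (-(θ * K.p * a i ^ 2))) := by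
  have hp := K.p_pos
  -- The share `1 - θ` of the energy gives the exponential rate, and the share `θ` gives a Gaussian
  -- that makes the integral converge.
  have hsplit : K.configEnergy a = ENNReal.ofReal (1 - θ) * K.configEnergy a +
      ENNReal.ofReal θ * K.configEnergy a := by
    rw [← add_mul, ← ENNReal.ofReal_add (by linarith) hθ.le]; simp
  have h1 : expNeg (ENNReal.ofReal (1 - θ) * K.configEnergy a) ≤
      ENNReal.ofReal (Real.exp (-((1 - θ) * (e * n ^ 2)))) := by
    refine le_trans (expNeg_antitone ?_) (expNeg_ofReal_le _)
    rw [ENNReal.ofReal_mul (by linarith)]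
    gcongr
  have h2 : expNeg (ENNReal.ofReal θ * K.configEnergy a) ≤
      ∏ i, ENNReal.ofReal (Real.exp (-(θ * K.p * a i ^ 2))) := by
    calc _ ≤ expNeg (∑ i, ENNReal.ofReal (θ * K.p * a i ^ 2)) := by
          refine expNeg_antitone ?_
          have h3 : ∑ i, ENNReal.ofReal (K.p * a i ^ 2) ≤ K.configEnergy a := by
            refine le_trans ?_ (K.sum_sq_le_configEnergy a)
            refine le_mul_of_one_le_left' ?_
            exact_mod_cast (by omega : 1 ≤ n - 1)
          calc _ = ENNReal.ofReal θ * ∑ i, ENNReal.ofReal (K.p * a i ^ 2) := by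
                rw [Finset.mul_sum]
                refine Finset.sum_congr rfl fun i _ => ?_
                rw [← ENNReal.ofReal_mul hθ.le, mul_assoc]
            _ ≤ _ := by gcongr
      _ = _ := by
          rw [expNeg_sum]
          exact Finset.prod_congr rfl fun i _ => expNeg_ofReal (by positivity)
  rw [hsplit, expNeg_add]
  gcongr

lemma eventually_partitionFn_le {w : ℝ → ℝ≥0∞} (hw : Measurable w)
    (hgauss : ∀ τ : ℝ, 0 < τ → ∫⁻ x, w x * ENNReal.ofReal (Real.exp (-(τ * x ^ 2))) ≠ ⊤)
    {y : ℝ} (hy : -K.minEnergy.toReal < y) :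
    ∀ᶠ n : ℕ in atTop, K.partitionFn w n ≤ ENNReal.ofReal (Real.exp (y * n ^ 2)) := by
  obtain ⟨e, he1, he2⟩ := exists_between (neg_lt.1 hy)
  -- Chosen so that `θ * |e| < e + y`. The rate `(1 - θ) * e` then still exceeds `-y`, whatever the
  -- sign of `e`, and the excess times `n ^ 2` absorbs the factor `A ^ n`.
  set θ : ℝ := (e + y) / (e + y + |e| + 1) with hθdef
  have hey : 0 < e + y := by linarith
  have hden : 0 < e + y + |e| + 1 := by positivity
  have hθ : 0 < θ := by positivity
  have hθ1 : θ < 1 := by rw [hθdef, div_lt_one hden]; linarith [abs_nonneg e]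
  have hd : 0 < y + (1 - θ) * e := by
    have h1 : θ * |e| < e + y := by
      rw [hθdef, div_mul_eq_mul_div, div_lt_iff₀ hden]
      nlinarith [abs_nonneg e]
    have h2 : θ * e ≤ θ * |e| := by gcongr; exact le_abs_self e
    linarith
  have hp := K.p_pos
  set A := ∫⁻ x, w x * ENNReal.ofReal (Real.exp (-(θ * K.p * x ^ 2))) with hA
  have hAtop : A ≠ ⊤ := hgauss _ (by positivity)
  have hAle : A ≤ ENNReal.ofReal (Real.exp A.toReal) := by
    rw [ENNReal.le_ofReal_iff_toReal_le hAtop (Real.exp_pos _).le]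
    linarith [Real.add_one_le_exp A.toReal]
  have hmeas : Measurable fun x : ℝ => w x * ENNReal.ofReal (Real.exp (-(θ * K.p * x ^ 2))) :=
    hw.mul (by fun_prop)
  filter_upwards [K.eventually_le_configEnergy he2, eventually_ge_atTop 2,
    eventually_mul_le_mul_sq A.toReal hd] with n hn hn2 hnA
  calc K.partitionFn w n
      ≤ ∫⁻ a : Fin n → ℝ, ENNReal.ofReal (Real.exp (-((1 - θ) * (e * n ^ 2)))) *
          ∏ i, (w (a i) * ENNReal.ofReal (Real.exp (-(θ * K.p * a i ^ 2)))) := by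
        refine lintegral_mono fun a => ?_
        calc _ ≤ (ENNReal.ofReal (Real.exp (-((1 - θ) * (e * n ^ 2)))) *
              ∏ i, ENNReal.ofReal (Real.exp (-(θ * K.p * a i ^ 2)))) * ∏ i, w (a i) := by
              gcongr
              exact K.expNeg_configEnergy_le hn2 hθ hθ1 (hn a)
          _ = _ := by rw [Finset.prod_mul_distrib]; ring
    _ = ENNReal.ofReal (Real.exp (-((1 - θ) * (e * n ^ 2)))) * A ^ n := by
        rw [lintegral_const_mul' _ _ ENNReal.ofReal_ne_top, volume_pi,
          lintegral_pi_prod_eq_pow _ hmeas]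
    _ ≤ ENNReal.ofReal (Real.exp (-((1 - θ) * (e * n ^ 2)))) *
          ENNReal.ofReal (Real.exp A.toReal) ^ n := by gcongr
    _ ≤ _ := by
        rw [← ENNReal.ofReal_pow (Real.exp_pos _).le, ← ENNReal.ofReal_mul (Real.exp_pos _).le,
          ← Real.exp_nat_mul, ← Real.exp_add]
        apply ENNReal.ofReal_le_ofReal
        apply Real.exp_le_exp.2
        linarith

/-! ### Lower bound for the partition function -/

lemma lintegral_configEnergy {ν : Measure ℝ} [IsProbabilityMeasure ν] (n : ℕ) :
    ∫⁻ a : Fin n → ℝ, K.configEnergy a ∂(Measure.pi fun _ => ν) =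
      (n * (n - 1) : ℕ) * K.totalEnergy ν := by
  have hm : ∀ i j : Fin n, Measurable fun a : Fin n → ℝ => K.pairEnergy (a i) (a j) := fun i j =>
    K.measurable_pairEnergy.comp (f := fun a : Fin n → ℝ => (a i, a j)) (by fun_prop)
  have hm2 : ∀ i j : Fin n, Measurable fun a : Fin n → ℝ =>
      K.pairEnergy (a i) (a j) + K.pairEnergy (a i) (a j) := fun i j => (hm i j).add (hm i j)
  unfold configEnergy
  rw [lintegral_finsetSum _ fun i _ => Finset.measurable_sum _ fun j _ => hm2 i j]
  have h := sum_Ioi_add fun _ : Fin n => K.totalEnergy ν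
  rw [Finset.sum_const, Finset.card_univ, Fintype.card_fin, smul_smul, nsmul_eq_mul] at h
  rw [← h]
  refine Finset.sum_congr rfl fun i _ => ?_
  rw [lintegral_finsetSum _ fun j _ => hm2 i j]
  refine Finset.sum_congr rfl fun j hj => ?_
  have hij : i ≠ j := (Finset.mem_Ioi.1 hj).ne
  rw [lintegral_add_left (hm i j)]
  rw [lintegral_pi_pair hij K.measurable_pairEnergy]
  rfl

lemma lintegral_sq_ne_top {ν : Measure ℝ} [IsProbabilityMeasure ν] (h : K.totalEnergy ν ≠ ⊤)
    (m : ℝ≥0) : ∫⁻ x, ENNReal.ofReal (m * x ^ 2) ∂ν ≠ ⊤ := by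
  have hp := K.p_pos
  have h1 : ENNReal.ofReal (K.p / 2) * ∫⁻ x, ENNReal.ofReal (x ^ 2) ∂ν ≤ K.totalEnergy ν := by
    rw [← lintegral_const_mul _ (by fun_prop)]
    calc _ = ∫⁻ z, ENNReal.ofReal (K.p / 2) * ENNReal.ofReal (z.1 ^ 2) ∂(ν.prod ν) := by
          rw [lintegral_prod _ (by fun_prop)]; simp
      _ ≤ _ := by
          refine lintegral_mono fun z => ?_
          refine le_trans ?_ (K.ofReal_sq_le_pairEnergy z.1 z.2)
          rw [← ENNReal.ofReal_mul (by positivity)]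
          apply ENNReal.ofReal_le_ofReal
          have : 0 ≤ K.p / 2 * z.2 ^ 2 := by positivity
          linarith
  have h2 : ∫⁻ x, ENNReal.ofReal (x ^ 2) ∂ν ≠ ⊤ := by
    intro htop
    rw [htop, ENNReal.mul_top (by simpa using hp)] at h1
    exact h (top_le_iff.1 h1)
  simp_rw [ENNReal.ofReal_mul m.coe_nonneg]
  rw [lintegral_const_mul _ (by fun_prop)]
  exact ENNReal.mul_ne_top ENNReal.ofReal_ne_top h2

/-- Jensen's inequality under the product law `ν^{⊗n}`, followed by the comparison of this law with
Lebesgue measure. The mean of the configuration energy is exact, since distinct coordinates are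
independent. -/
lemma le_partitionFn {w h : ℝ → ℝ≥0∞} (hh : Measurable h) (hwh : ∀ x, expNeg (h x) ≤ w x)
    {ν : Measure ℝ} [IsProbabilityMeasure ν] {C : ℝ}
    (hν : ν ≤ ENNReal.ofReal C • volume) (n : ℕ) :
    expNeg ((n * (n - 1) : ℕ) * K.totalEnergy ν + n * ∫⁻ x, h x ∂ν) ≤
      ENNReal.ofReal C ^ n * K.partitionFn w n := by
  have hi : ∀ i : Fin n, Measurable fun a : Fin n → ℝ => h (a i) := fun i =>
    hh.comp (measurable_pi_apply i)
  have hsum : Measurable fun a : Fin n → ℝ => ∑ i, h (a i) := Finset.measurable_sum _ fun i _ => hi i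
  have hS := (K.measurable_configEnergy n).add hsum
  calc _ = expNeg (∫⁻ a : Fin n → ℝ, (K.configEnergy a + ∑ i, h (a i))
        ∂(Measure.pi fun _ => ν)) := by
        rw [lintegral_add_left (K.measurable_configEnergy n), lintegral_configEnergy,
          lintegral_finsetSum _ fun i _ => hi i]
        congr 2
        simp_rw [fun i : Fin n => (measurePreserving_eval (fun _ : Fin n => ν) i).lintegral_comp hh]
        simp
    _ ≤ ∫⁻ a : Fin n → ℝ, expNeg (K.configEnergy a + ∑ i, h (a i)) ∂(Measure.pi fun _ => ν) :=
        expNeg_lintegral_le _ hS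
    _ ≤ ∫⁻ a : Fin n → ℝ, expNeg (K.configEnergy a) * ∏ i, w (a i) ∂(Measure.pi fun _ => ν) := by
        refine lintegral_mono fun a => ?_
        rw [expNeg_add, expNeg_sum]
        gcongr
        exact hwh _
    _ ≤ ∫⁻ a : Fin n → ℝ, expNeg (K.configEnergy a) * ∏ i, w (a i)
          ∂(ENNReal.ofReal C ^ n • Measure.pi fun _ => volume) :=
        lintegral_mono' (pi_le_of_le_smul hν n) le_rfl
    _ = _ := by rw [lintegral_smul_measure]; rfl

lemma eventually_le_partitionFn {w h : ℝ → ℝ≥0∞} (hh : Measurable h)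
    (hwh : ∀ x, expNeg (h x) ≤ w x)
    (hfin : ∀ (ν : Measure ℝ) (C : ℝ), IsProbabilityMeasure ν → ν ≤ ENNReal.ofReal C • volume →
      K.totalEnergy ν ≠ ⊤ → ∫⁻ x, h x ∂ν ≠ ⊤)
    {y : ℝ} (hy : y < -K.minEnergy.toReal) :
    ∀ᶠ n : ℕ in atTop, ENNReal.ofReal (Real.exp (y * n ^ 2)) ≤ K.partitionFn w n := by
  obtain ⟨e, he1, he2⟩ := exists_between (lt_neg.1 hy)
  have he0 : 0 < e := ENNReal.toReal_nonneg.trans_lt he1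
  have hJ : K.minEnergy < ENNReal.ofReal e :=
    (ENNReal.lt_ofReal_iff_toReal_lt K.minEnergy_ne_top).2 he1
  obtain ⟨μ, hμ⟩ := iInf_lt_iff.1 hJ
  obtain ⟨ν, C, hν, hC, hle, hνe⟩ := K.exists_smooth_totalEnergy_lt (μ : Measure ℝ) hμ
  have hI : K.totalEnergy ν ≠ ⊤ := (hνe.trans ENNReal.ofReal_lt_top).ne
  have hH := hfin ν C hν hle hI
  set H := (∫⁻ x, h x ∂ν).toReal with hHdef
  -- The gap `-y - e` pays for the terms linear in `n`: the one-body cost `n * H` and the density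
  -- factor `C ^ n`.
  filter_upwards [eventually_mul_le_mul_sq (H + Real.log C) (show 0 < -y - e by linarith)]
    with n hn
  have h1 : ((n * (n - 1) : ℕ) : ℝ≥0∞) * K.totalEnergy ν + n * ∫⁻ x, h x ∂ν ≤
      ENNReal.ofReal (n ^ 2 * e + n * H) := by
    rw [ENNReal.ofReal_add (by positivity) (by positivity), ENNReal.ofReal_mul (by positivity),
      ENNReal.ofReal_mul (by positivity), ENNReal.ofReal_pow (by positivity), ENNReal.ofReal_natCast,
      hHdef, ENNReal.ofReal_toReal hH]
    gcongr
    exact_mod_cast (by rw [sq]; exact Nat.mul_le_mul_left _ (Nat.sub_le _ _) : n * (n - 1) ≤ n ^ 2)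
  have h2 := (expNeg_antitone h1).trans (K.le_partitionFn hh hwh hle n)
  rw [expNeg_ofReal (by positivity)] at h2
  have hCn : ENNReal.ofReal C ^ n ≠ 0 := by simpa using fun h => absurd hC (not_lt.2 h)
  rw [← ENNReal.mul_le_mul_iff_right hCn (by finiteness)]
  refine le_trans ?_ h2
  rw [← ENNReal.ofReal_pow hC.le, ← ENNReal.ofReal_mul (by positivity)]
  apply ENNReal.ofReal_le_ofReal
  nth_rewrite 1 [← Real.exp_log hC]
  rw [← Real.exp_nat_mul, ← Real.exp_add]
  apply Real.exp_le_exp.2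
  linarith

lemma lintegral_oneBodyCost_ne_top (m α γ : ℝ≥0) (ν : Measure ℝ) (C : ℝ)
    (_ : IsProbabilityMeasure ν) (hν : ν ≤ ENNReal.ofReal C • volume)
    (h : K.totalEnergy ν ≠ ⊤) : ∫⁻ x, oneBodyCost m α γ x ∂ν ≠ ⊤ := by
  have hr := continuous_repulsion.measurable
  have hr2 : Measurable fun x : ℝ => repulsion (2 * x) := hr.comp (measurable_const_mul 2)
  have hB : (3 + 2 * (ENNReal.ofReal C * ∫⁻ x, invSqrtNear x) : ℝ≥0∞) ≠ ⊤ := by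
    have := lintegral_invSqrtNear_ne_top
    finiteness
  unfold oneBodyCost
  rw [lintegral_add_right _ (hr2.const_mul _), lintegral_add_right _ (hr.const_mul _),
    lintegral_const_mul _ hr, lintegral_const_mul _ hr2]
  have h1 := ne_top_of_le_ne_top hB (lintegral_repulsion_le hν 1 le_rfl)
  have h2 := ne_top_of_le_ne_top hB (lintegral_repulsion_le hν 2 one_le_two)
  simp only [one_mul] at h1
  exact ENNReal.add_ne_top.2 ⟨ENNReal.add_ne_top.2 ⟨K.lintegral_sq_ne_top h m, by finiteness⟩,
    by finiteness⟩

end Coupling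

/-! ### The energy functionals in terms of the shifted two-body energy -/

/-- The negative part of `g - b` is at most `b`, so its integral is finite and no `∞ - ∞` occurs.
The proof integrates the pointwise identity `(g - b)⁺ + b = g + (g - b)⁻` in `[0, ∞]`. -/
lemma extIntegral_sub_const {X : Type*} [MeasurableSpace X] (P : Measure X) [IsProbabilityMeasure P]
    {g : X → ℝ≥0∞} (hg : Measurable g) {b : ℝ} (hb : 0 ≤ b) :
    extIntegral P (fun x => (g x : EReal) - (b : EReal)) =
      ((∫⁻ x, g x ∂P : ℝ≥0∞) : EReal) - (b : EReal) := by
  have hcase : ∀ y : ℝ≥0∞, ((y : EReal) - (b : EReal)).toENNReal + ENNReal.ofReal b =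
      y + (-((y : EReal) - (b : EReal))).toENNReal := by
    intro y
    induction y with
    | top => simp
    | coe y =>
      rw [show ((y : ℝ≥0∞) : EReal) = ((y : ℝ) : EReal) from rfl, ← EReal.coe_sub, ← EReal.coe_neg,
        EReal.real_coe_toENNReal, EReal.real_coe_toENNReal, ← ENNReal.ofReal_coe_nnreal]
      rcases le_total (y : ℝ) b with h | h
      · rw [ENNReal.ofReal_of_nonpos (by linarith), ← ENNReal.ofReal_add y.coe_nonneg (by linarith)]
        simp
      · rw [ENNReal.ofReal_of_nonpos (p := -((y : ℝ) - b)) (by linarith),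
          ← ENNReal.ofReal_add (by linarith) hb]
        simp
  have hneg : ∀ y : ℝ≥0∞, (-((y : EReal) - (b : EReal))).toENNReal ≤ ENNReal.ofReal b := by
    intro y
    rw [← EReal.real_coe_toENNReal]
    apply EReal.toENNReal_le_toENNReal
    induction y with
    | top => simp
    | coe y =>
      rw [show ((y : ℝ≥0∞) : EReal) = ((y : ℝ) : EReal) from rfl]
      norm_cast
      linarith [y.coe_nonneg]
  have hmn : Measurable fun x => (-((g x : EReal) - (b : EReal))).toENNReal := by
    have : Measurable fun y : ℝ≥0∞ => (-((y : EReal) - (b : EReal))).toENNReal := by fun_prop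
    exact this.comp hg
  have hint : ∫⁻ x, ((g x : EReal) - (b : EReal)).toENNReal ∂P + ENNReal.ofReal b =
      ∫⁻ x, g x ∂P + ∫⁻ x, (-((g x : EReal) - (b : EReal))).toENNReal ∂P := by
    have h := lintegral_congr (μ := P) fun x => hcase (g x)
    rw [lintegral_add_right _ measurable_const, lintegral_add_right _ hmn] at h
    simpa using h
  have hN : ∫⁻ x, (-((g x : EReal) - (b : EReal))).toENNReal ∂P ≤ ENNReal.ofReal b := by
    simpa using lintegral_mono (μ := P) fun x => hneg (g x)
  unfold extIntegral
  generalize ∫⁻ x, ((g x : EReal) - (b : EReal)).toENNReal ∂P = p at *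
  generalize ∫⁻ x, (-((g x : EReal) - (b : EReal))).toENNReal ∂P = n at *
  generalize ∫⁻ x, g x ∂P = t at *
  lift n to ℝ≥0 using ne_top_of_le_ne_top ENNReal.ofReal_ne_top hN
  have hnr : ((n : ℝ≥0∞) : EReal) = ((n : ℝ) : EReal) := rfl
  induction t with
  | top =>
    have : p = ⊤ := by
      by_contra hp
      have : p + ENNReal.ofReal b ≠ ⊤ := ENNReal.add_ne_top.2 ⟨hp, ENNReal.ofReal_ne_top⟩
      simp [hint] at this
    simp [this, hnr]
  | coe t =>
    have hp : p ≠ ⊤ := by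
      rintro rfl
      rw [top_add] at hint
      exact ENNReal.add_ne_top.2 ⟨ENNReal.coe_ne_top, ENNReal.coe_ne_top⟩ hint.symm
    lift p to ℝ≥0 using hp
    have htr : ((t : ℝ≥0∞) : EReal) = ((t : ℝ) : EReal) := rfl
    have hpr : ((p : ℝ≥0∞) : EReal) = ((p : ℝ) : EReal) := rfl
    rw [hpr, hnr, htr, ← EReal.coe_sub, ← EReal.coe_sub]
    rw [← ENNReal.ofReal_coe_nnreal, ← ENNReal.ofReal_coe_nnreal (p := t),
      ← ENNReal.ofReal_coe_nnreal (p := n), ← ENNReal.ofReal_add p.coe_nonneg hb,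
      ← ENNReal.ofReal_add t.coe_nonneg n.coe_nonneg,
      ENNReal.ofReal_eq_ofReal_iff (by positivity) (by positivity)] at hint
    congr 1
    linarith

lemma coe_mul_ell (q : ℝ≥0) (x : ℝ) :
    ((q : ℝ) : EReal) * ell x = ((q * |x| : ℝ) : EReal) - ((q * repulsion x : ℝ≥0∞) : EReal) := by
  rw [ell_eq]
  -- The case `q = 0` is separate because of the singular point: `0 * ⊥ = 0` on the left agrees with
  -- `0 * ⊤ = 0` on the right.
  rcases eq_or_ne q 0 with rfl | hq
  · simp
  have hq' : 0 < (q : ℝ) := by positivity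
  induction repulsion x with
  | top =>
    rw [ENNReal.mul_top (by simpa using hq)]
    simp [EReal.coe_mul_bot_of_pos hq']
  | coe r =>
    rw [show ((r : ℝ≥0∞) : EReal) = ((r : ℝ) : EReal) from rfl, ← ENNReal.coe_mul,
      show (((q * r : ℝ≥0) : ℝ≥0∞) : EReal) = ((q * r : ℝ) : EReal) from rfl]
    norm_cast
    push_cast; ring

/-- If one of the four singular terms is infinite, both sides are `⊤`; otherwise this is an identity
of real numbers. The doubled terms `m₁ + m₁` cancel against the factor `1 / 2`. -/
lemma ereal_energy_identity (w₁ w₂ a₁ a₂ d₁ d₂ b : ℝ) (R n₁ n₂ m₁ m₂ : ℝ≥0∞)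
    (hR : R = ENNReal.ofReal ((w₁ - a₁) / 2 + (w₂ - a₂) / 2 - d₁ - d₂ + b))
    (hR0 : 0 ≤ (w₁ - a₁) / 2 + (w₂ - a₂) / 2 - d₁ - d₂ + b) :
    ((1 / 2 : ℝ) : EReal) * ((w₁ : EReal) - ((a₁ : EReal) - ((m₁ + m₁ : ℝ≥0∞) : EReal)))
      + ((1 / 2 : ℝ) : EReal) * ((w₂ : EReal) - ((a₂ : EReal) - ((m₂ + m₂ : ℝ≥0∞) : EReal)))
      - (((d₁ : EReal) - (n₁ : EReal)) + ((d₂ : EReal) - (n₂ : EReal))) =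
    ((R + n₁ + n₂ + (m₁ + m₂) : ℝ≥0∞) : EReal) - (b : EReal) := by
  have hc : ∀ r : ℝ≥0, ((r : ℝ≥0∞) : EReal) = ((r : ℝ) : EReal) := fun r => rfl
  subst hR
  have h2 : (0 : ℝ) < 1 / 2 := by norm_num
  induction m₁ <;> induction m₂ <;> induction n₁ <;> induction n₂
  case coe.coe.coe.coe m₁ m₂ n₁ n₂ =>
    simp only [EReal.coe_ennreal_add, EReal.coe_ennreal_ofReal, max_eq_left hR0, hc]
    norm_cast
    push_cast; ring
  all_goals
    simp only [EReal.coe_ennreal_add, EReal.coe_ennreal_ofReal, max_eq_left hR0, hc,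
      EReal.coe_ennreal_top]
    simp only [sub_eq_add_neg, EReal.neg_top, EReal.neg_bot, EReal.add_bot, EReal.bot_add,
      EReal.top_add_top, ← EReal.coe_neg, ← EReal.coe_add, ← EReal.coe_mul,
      EReal.coe_mul_top_of_pos h2, EReal.coe_add_top, EReal.top_add_coe]

namespace Coupling

variable (K : Coupling)

lemma shift_nonneg : 0 ≤ K.shift := by
  have := K.p_pos
  unfold shift; positivity

lemma ereal_pairEnergy (x y : ℝ) :
    ((1 / 2 : ℝ) : EReal) * (((2 * K.p * x ^ 2 : ℝ) : EReal) - ((2 * K.s : ℝ) : EReal) * ell x)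
      + ((1 / 2 : ℝ) : EReal) * (((2 * K.p * y ^ 2 : ℝ) : EReal) - ((2 * K.s : ℝ) : EReal) * ell y)
      - (((K.q : ℝ) : EReal) * ell (x - y) + ((K.q' : ℝ) : EReal) * ell (x + y)) =
    (K.pairEnergy x y : EReal) - (K.shift : EReal) := by
  have hs : ∀ z, ((2 * K.s : ℝ) : EReal) * ell z = ((2 * K.s * |z| : ℝ) : EReal) -
      ((K.s * repulsion z + K.s * repulsion z : ℝ≥0∞) : EReal) := fun z => by
    have := coe_mul_ell (2 * K.s) z
    rw [NNReal.coe_mul, NNReal.coe_ofNat, ENNReal.coe_mul, ENNReal.coe_ofNat, mul_assoc (2 : ℝ≥0∞),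
      two_mul (_ * _ : ℝ≥0∞)] at this
    exact this
  have e : (2 * K.p * x ^ 2 - 2 * K.s * |x|) / 2 + (2 * K.p * y ^ 2 - 2 * K.s * |y|) / 2
      - K.q * |x - y| - K.q' * |x + y| + K.shift = K.regular x y := by
    unfold regular; ring
  rw [hs, hs, coe_mul_ell, coe_mul_ell, ereal_energy_identity _ _ _ _ _ _ K.shift
    (ENNReal.ofReal (K.regular x y)) _ _ _ _ (by rw [e]) (by rw [e]; exact K.regular_nonneg x y),
    pairEnergy, mul_add]

lemma extIntegral_pairEnergy (μ : ProbabilityMeasure ℝ) :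
    extIntegral ((μ : Measure ℝ).prod (μ : Measure ℝ))
      (fun z => (K.pairEnergy z.1 z.2 : EReal) - (K.shift : EReal)) =
      (K.totalEnergy (μ : Measure ℝ) : EReal) - (K.shift : EReal) :=
  extIntegral_sub_const _ K.measurable_pairEnergy K.shift_nonneg

lemma iInf_totalEnergy_sub :
    ⨅ μ : ProbabilityMeasure ℝ, ((K.totalEnergy (μ : Measure ℝ) : EReal) - (K.shift : EReal)) =
      ((K.minEnergy.toReal - K.shift : ℝ) : EReal) := by
  have hJ : ((K.minEnergy.toReal - K.shift : ℝ) : EReal) =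
      (K.minEnergy : EReal) - (K.shift : EReal) := by
    rw [EReal.coe_sub]
    congr 1
    nth_rewrite 2 [← ENNReal.ofReal_toReal K.minEnergy_ne_top]
    rw [EReal.coe_ennreal_ofReal, max_eq_left ENNReal.toReal_nonneg]
  refine le_antisymm (le_of_forall_gt fun a ha => ?_) (le_iInf fun μ => ?_)
  · obtain ⟨y, hy1, hy2⟩ := EReal.lt_iff_exists_real_btwn.1 ha
    rw [EReal.coe_lt_coe_iff, sub_lt_iff_lt_add] at hy1
    have h0 : 0 < y + K.shift := ENNReal.toReal_nonneg.trans_lt hy1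
    obtain ⟨μ, hμ⟩ := iInf_lt_iff.1 ((ENNReal.lt_ofReal_iff_toReal_lt K.minEnergy_ne_top).2 hy1)
    refine lt_of_le_of_lt ((iInf_le _ μ).trans ?_) hy2
    calc _ ≤ ((ENNReal.ofReal (y + K.shift) : ℝ≥0∞) : EReal) - (K.shift : EReal) :=
          EReal.sub_le_sub (by exact_mod_cast hμ.le) le_rfl
      _ = y := by
          rw [EReal.coe_ennreal_ofReal, max_eq_left h0.le, ← EReal.coe_sub, add_sub_cancel_right]
  · rw [hJ]
    refine EReal.sub_le_sub (EReal.coe_ennreal_le_coe_ennreal_iff.2 ?_) le_rfl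
    exact iInf_le (fun μ : ProbabilityMeasure ℝ => K.totalEnergy (μ : Measure ℝ)) μ

/-! ### Logarithmic asymptotics -/

lemma _root_.LogSinh.scaledLog_mono (r : ℕ) {Z Z' : ℝ≥0∞} (h : Z ≤ Z') :
    scaledLog r Z ≤ scaledLog r Z' := by
  unfold scaledLog
  refine mul_le_mul_of_nonneg_left (ENNReal.log_monotone h) ?_
  exact_mod_cast (by positivity : (0 : ℝ) ≤ 1 / (r : ℝ) ^ 2)

lemma _root_.LogSinh.scaledLog_ofReal_exp (r : ℕ) (u : ℝ) :
    scaledLog r (ENNReal.ofReal (Real.exp u)) = ((u / (r : ℝ) ^ 2 : ℝ) : EReal) := by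
  rw [scaledLog, ENNReal.log_ofReal_of_pos (Real.exp_pos u), Real.log_exp, ← EReal.coe_mul]
  congr 1; ring

/-- The two bounds on the partition function give the rate `-minEnergy` in terms of `n ^ 2`; the
ratio `n / r → 1` lets the number of points differ from the rank, as it does in type A. -/
lemma tendsto_scaledLog {m α γ : ℝ≥0} {Z : ℕ → ℝ≥0∞} {u : ℕ → ℝ} {n : ℕ → ℕ} {L : ℝ}
    (hZ : ∀ᶠ r in atTop, Z r =
      ENNReal.ofReal (Real.exp (u r)) * K.partitionFn (oneBody m α γ) (n r))
    (hu : Tendsto (fun r : ℕ => u r / (r : ℝ) ^ 2) atTop (𝓝 L))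
    (hn : Tendsto (fun r : ℕ => (n r : ℝ) / r) atTop (𝓝 1)) (hn' : Tendsto n atTop atTop) :
    Tendsto (fun r => scaledLog r (Z r)) atTop
      (𝓝 ((L - K.minEnergy.toReal : ℝ) : EReal)) := by
  have hlim : ∀ y : ℝ, Tendsto (fun r : ℕ => (u r + y * (n r : ℝ) ^ 2) / (r : ℝ) ^ 2) atTop
      (𝓝 (L + y)) := fun y => by
    have := hu.add ((hn.pow 2).const_mul y)
    rw [one_pow, mul_one] at this
    refine this.congr fun r => ?_
    rw [div_pow]; ring
  rw [tendsto_order]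
  constructor
  · intro a ha
    obtain ⟨l, hl1, hl2⟩ := EReal.lt_iff_exists_real_btwn.1 ha
    rw [EReal.coe_lt_coe_iff] at hl2
    obtain ⟨y, hy1, hy2⟩ := exists_between (show l - L < -K.minEnergy.toReal by linarith)
    have hlow := hn'.eventually (K.eventually_le_partitionFn (measurable_oneBodyCost m α γ)
      (expNeg_oneBodyCost_le m α γ) (K.lintegral_oneBodyCost_ne_top m α γ) hy2)
    filter_upwards [hZ, hlow, (hlim y).eventually_const_lt (show l < L + y by linarith)]
      with r h1 h2 h3
    refine hl1.trans (lt_of_lt_of_le (EReal.coe_lt_coe_iff.2 h3) ?_)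
    rw [← scaledLog_ofReal_exp, h1, Real.exp_add, ENNReal.ofReal_mul (Real.exp_pos _).le]
    exact scaledLog_mono r (by gcongr)
  · intro a ha
    obtain ⟨l, hl1, hl2⟩ := EReal.lt_iff_exists_real_btwn.1 ha
    rw [EReal.coe_lt_coe_iff] at hl1
    obtain ⟨y, hy1, hy2⟩ := exists_between (show -K.minEnergy.toReal < l - L by linarith)
    have hup := hn'.eventually (K.eventually_partitionFn_le (measurable_oneBody m α γ)
      (fun τ hτ => lintegral_oneBody_mul_gaussian_ne_top m α γ hτ) hy1)
    filter_upwards [hZ, hup, (hlim y).eventually_lt_const (show L + y < l by linarith)]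
      with r h1 h2 h3
    refine lt_of_le_of_lt ?_ ((EReal.coe_lt_coe_iff.2 h3).trans hl2)
    rw [← scaledLog_ofReal_exp, h1, Real.exp_add, ENNReal.ofReal_mul (Real.exp_pos _).le]
    exact scaledLog_mono r (by gcongr)

end Coupling

/-! ### The integrands of the partition functions -/

lemma prod_Ioi_mul {n : ℕ} {M : Type*} [CommMonoid M] (f : Fin n → M) :
    ∏ i, ∏ j ∈ Finset.Ioi i, (f i * f j) = ∏ i, f i ^ (n - 1) := by
  have h := Finset.prod_prod_Ioi_mul_eq_prod_prod_off_diag fun _ j : Fin n => f j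
  rw [h]
  refine Finset.prod_congr rfl fun i _ => ?_
  rw [Finset.prod_const, Finset.card_compl, Finset.card_singleton, Fintype.card_fin]

namespace Coupling

variable (K : Coupling)

/-- The factor of the two-body weight that depends on `x ± y`. -/
noncomputable def crossWeight (x y : ℝ) : ℝ :=
  |Real.sinh (x - y)| ^ (2 * K.q : ℝ) * |Real.sinh (x + y)| ^ (2 * K.q' : ℝ)

/-- The factor of the two-body weight that depends on one variable. -/
noncomputable def sideWeight (x : ℝ) : ℝ :=
  Real.exp (-(2 * K.p * x ^ 2)) * |Real.sinh x| ^ (2 * K.s : ℝ)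

lemma crossWeight_nonneg (x y : ℝ) : 0 ≤ K.crossWeight x y := by unfold crossWeight; positivity

lemma sideWeight_nonneg (x : ℝ) : 0 ≤ K.sideWeight x := by unfold sideWeight; positivity

lemma exp_shift_mul_expNeg_pairEnergy (x y : ℝ) :
    ENNReal.ofReal (Real.exp K.shift) * expNeg (K.pairEnergy x y) =
      ENNReal.ofReal (Real.exp (-(K.p * (x ^ 2 + y ^ 2))) * (|Real.sinh (x - y)| ^ (K.q : ℝ) *
        |Real.sinh (x + y)| ^ (K.q' : ℝ) * (|Real.sinh x| ^ (K.s : ℝ) * |Real.sinh y| ^ (K.s : ℝ)))) := by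
  rw [ENNReal.ofReal_mul (by positivity), ENNReal.ofReal_mul (by positivity),
    ENNReal.ofReal_mul (by positivity), ENNReal.ofReal_mul (by positivity),
    ofReal_abs_sinh_rpow, ofReal_abs_sinh_rpow, ofReal_abs_sinh_rpow, ofReal_abs_sinh_rpow,
    pairEnergy, mul_add, expNeg_add, expNeg_add, expNeg_add, expNeg_add,
    expNeg_ofReal (K.regular_nonneg x y)]
  have e : Real.exp K.shift * Real.exp (-K.regular x y) =
      Real.exp (-(K.p * (x ^ 2 + y ^ 2))) * Real.exp (K.q * |x - y|) * Real.exp (K.q' * |x + y|) *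
        Real.exp (K.s * |x|) * Real.exp (K.s * |y|) := by
    simp only [← Real.exp_add]
    congr 1
    unfold regular; ring
  have e' := congrArg ENNReal.ofReal e
  rw [ENNReal.ofReal_mul (by positivity), ENNReal.ofReal_mul (by positivity),
    ENNReal.ofReal_mul (by positivity), ENNReal.ofReal_mul (by positivity),
    ENNReal.ofReal_mul (by positivity)] at e'
  simp only [← mul_assoc]
  rw [e']
  ring

lemma exp_shift_mul_expNeg_add (x y : ℝ) :
    (ENNReal.ofReal (Real.exp K.shift) * ENNReal.ofReal (Real.exp K.shift)) *
        expNeg (K.pairEnergy x y + K.pairEnergy x y) =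
      (ENNReal.ofReal (K.sideWeight x) * ENNReal.ofReal (K.sideWeight y)) *
        ENNReal.ofReal (K.crossWeight x y) := by
  rw [expNeg_add, mul_mul_mul_comm, exp_shift_mul_expNeg_pairEnergy,
    ← ENNReal.ofReal_mul (by positivity), ← ENNReal.ofReal_mul (K.sideWeight_nonneg x),
    ← ENNReal.ofReal_mul (mul_nonneg (K.sideWeight_nonneg x) (K.sideWeight_nonneg y))]
  congr 1
  have h2 : ∀ (q : ℝ≥0) (z : ℝ), |z| ^ (2 * q : ℝ) = |z| ^ (q : ℝ) * |z| ^ (q : ℝ) := fun q z => by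
    rw [two_mul, Real.rpow_add_of_nonneg (abs_nonneg z) q.coe_nonneg q.coe_nonneg]
  have he : Real.exp (-(K.p * (x ^ 2 + y ^ 2))) * Real.exp (-(K.p * (x ^ 2 + y ^ 2))) =
      Real.exp (-(2 * K.p * x ^ 2)) * Real.exp (-(2 * K.p * y ^ 2)) := by
    simp only [← Real.exp_add]; congr 1; ring
  unfold sideWeight crossWeight
  simp only [h2]
  linear_combination (|Real.sinh (x - y)| ^ (K.q : ℝ) *
        |Real.sinh (x + y)| ^ (K.q' : ℝ) * (|Real.sinh x| ^ (K.s : ℝ) * |Real.sinh y| ^ (K.s : ℝ))) ^ 2 * he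

/-- Exact bookkeeping: each of the `n (n - 1) / 2` pairs carries the shift twice, and each variable
collects its side weight `n - 1` times. The one-body weight supplies what is left of the exponents.
-/
lemma weight_eq {n : ℕ} (a : Fin n → ℝ) (m α γ : ℝ≥0) :
    ENNReal.ofReal (Real.exp (K.shift * (n * (n - 1) : ℕ))) *
        (expNeg (K.configEnergy a) * ∏ i, oneBody m α γ (a i)) =
      ENNReal.ofReal ((∏ i, ∏ j ∈ Finset.Ioi i, K.crossWeight (a i) (a j)) *
        ∏ i, (Real.exp (-((2 * K.p * (n - 1 : ℕ) + m) * a i ^ 2)) *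
          |Real.sinh (a i)| ^ (2 * K.s * (n - 1 : ℕ) + α : ℝ) *
            |Real.sinh (2 * a i)| ^ (γ : ℝ))) := by
  have h1 : ENNReal.ofReal (Real.exp (K.shift * (n * (n - 1) : ℕ))) = ∏ i : Fin n,
      ∏ j ∈ Finset.Ioi i, (ENNReal.ofReal (Real.exp K.shift) * ENNReal.ofReal (Real.exp K.shift)) := by
    rw [prod_Ioi_mul fun _ : Fin n => ENNReal.ofReal (Real.exp K.shift), Finset.prod_const,
      Finset.card_univ, Fintype.card_fin, ← pow_mul, ← ENNReal.ofReal_pow (Real.exp_pos _).le,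
      ← Real.exp_nat_mul]
    congr 2; rw [mul_comm (n - 1)]; ring
  have h2 : expNeg (K.configEnergy a) = ∏ i, ∏ j ∈ Finset.Ioi i,
      expNeg (K.pairEnergy (a i) (a j) + K.pairEnergy (a i) (a j)) := by
    unfold configEnergy
    simp_rw [expNeg_sum]
  have h3 : ENNReal.ofReal (Real.exp (K.shift * (n * (n - 1) : ℕ))) * expNeg (K.configEnergy a) =
      (∏ i, ENNReal.ofReal (K.sideWeight (a i)) ^ (n - 1)) *
        ∏ i, ∏ j ∈ Finset.Ioi i, ENNReal.ofReal (K.crossWeight (a i) (a j)) := by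
    rw [h1, h2, ← prod_Ioi_mul, ← Finset.prod_mul_distrib, ← Finset.prod_mul_distrib]
    refine Finset.prod_congr rfl fun i _ => ?_
    rw [← Finset.prod_mul_distrib, ← Finset.prod_mul_distrib]
    exact Finset.prod_congr rfl fun j _ => K.exp_shift_mul_expNeg_add _ _
  have h4 : ∀ x : ℝ, ENNReal.ofReal (K.sideWeight x) ^ (n - 1) * oneBody m α γ x =
      ENNReal.ofReal (Real.exp (-((2 * K.p * (n - 1 : ℕ) + m) * x ^ 2)) *
          |Real.sinh x| ^ (2 * K.s * (n - 1 : ℕ) + α : ℝ) * |Real.sinh (2 * x)| ^ (γ : ℝ)) := by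
    intro x
    rw [oneBody, ← ENNReal.ofReal_pow (K.sideWeight_nonneg x),
      ← ENNReal.ofReal_mul (pow_nonneg (K.sideWeight_nonneg x) _)]
    congr 1
    have e1 : Real.exp (-((2 * K.p * (n - 1 : ℕ) + m) * x ^ 2)) =
        Real.exp (-(2 * K.p * x ^ 2)) ^ (n - 1) * Real.exp (-(m * x ^ 2)) := by
      rw [← Real.exp_nat_mul, ← Real.exp_add]; congr 1; ring
    rw [Real.rpow_add_of_nonneg (abs_nonneg _) (by positivity) α.coe_nonneg,
      Real.rpow_mul (abs_nonneg _), Real.rpow_natCast, e1, sideWeight, mul_pow]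
    ring
  rw [← mul_assoc, h3, mul_right_comm, ← Finset.prod_mul_distrib]
  simp_rw [h4]
  rw [mul_comm, ENNReal.ofReal_mul (Finset.prod_nonneg fun i _ => Finset.prod_nonneg fun j _ =>
    K.crossWeight_nonneg _ _), ENNReal.ofReal_prod_of_nonneg (fun i _ =>
      Finset.prod_nonneg fun j _ => K.crossWeight_nonneg _ _),
    ENNReal.ofReal_prod_of_nonneg (fun i _ => by positivity)]
  congr 1
  refine Finset.prod_congr rfl fun i _ => ?_
  rw [ENNReal.ofReal_prod_of_nonneg fun j _ => K.crossWeight_nonneg _ _]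

lemma exp_mul_partitionFn (m α γ : ℝ≥0) (n : ℕ) :
    ENNReal.ofReal (Real.exp (K.shift * (n * (n - 1) : ℕ))) * K.partitionFn (oneBody m α γ) n =
      ∫⁻ a : Fin n → ℝ, ENNReal.ofReal ((∏ i, ∏ j ∈ Finset.Ioi i, K.crossWeight (a i) (a j)) *
        ∏ i, (Real.exp (-((2 * K.p * (n - 1 : ℕ) + m) * a i ^ 2)) *
          |Real.sinh (a i)| ^ (2 * K.s * (n - 1 : ℕ) + α : ℝ) *
            |Real.sinh (2 * a i)| ^ (γ : ℝ))) := by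
  rw [partitionFn, ← lintegral_const_mul' _ _ ENNReal.ofReal_ne_top]
  simp_rw [weight_eq]

end Coupling

/-! ### Root systems of type BC -/

lemma gaussWeight_eq_prod (c σ : ℝ) {n : ℕ} (a : Fin n → ℝ) :
    gaussWeight c σ a = ∏ i, Real.exp (-(c / (2 * σ ^ 2) * a i ^ 2)) := by
  rw [gaussWeight, ← Real.exp_sum, Finset.mul_sum]
  congr 1
  exact Finset.sum_congr rfl fun i _ => by ring

lemma ZB_eq (κ c β α : ℝ) (r : ℕ) (σ : ℝ) : ZB κ c β α r σ = ZBC κ c β α 0 r σ := by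
  simp [ZB, ZBC]

lemma ZC_eq (κ c β γ : ℝ) (r : ℕ) (σ : ℝ) : ZC κ c β γ r σ = ZBC κ c β 0 γ r σ := by
  simp [ZC, ZBC]

lemma ZD_eq (κ c β : ℝ) (r : ℕ) (σ : ℝ) : ZD κ c β r σ = ZBC κ c β 0 0 r σ := by
  simp [ZD, ZBC]

lemma ZBC_eq (K : Coupling) (hK : K.q' = K.q) {κ c σ : ℝ} (hκ : 0 < κ) {α : ℝ} {m α' γ : ℝ≥0}
    {r : ℕ} (hc : c / (2 * σ ^ 2) = 2 * K.p * (r - 1 : ℕ) + m)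
    (hα : α = 2 * K.s * (r - 1 : ℕ) + α') :
    ZBC κ c (2 * K.q) α γ r σ =
      ENNReal.ofReal (Real.exp (r * Real.log κ + K.shift * (r * (r - 1) : ℕ))) *
        K.partitionFn (oneBody m α' γ) r := by
  rw [Real.exp_add, ENNReal.ofReal_mul (Real.exp_pos _).le, mul_assoc, K.exp_mul_partitionFn,
    Real.exp_nat_mul, Real.exp_log hκ, ZBC]
  congr 1
  refine lintegral_congr fun a => ?_
  congr 1
  rw [gaussWeight_eq_prod, hc, hα, prodMinusPlus]
  simp only [Coupling.crossWeight, hK, abs_mul, Real.mul_rpow (abs_nonneg _) (abs_nonneg _)]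
  rw [mul_right_comm, ← Finset.prod_mul_distrib, mul_comm]
  congr 1
  exact Finset.prod_congr rfl fun i _ => by ring

/-! ### Root systems of type A -/

/-- Fubini for an orthogonal decomposition, which preserves volume. -/
lemma lintegral_eq_lintegral_submodule {E : Type*} [NormedAddCommGroup E] [InnerProductSpace ℝ E]
    [FiniteDimensional ℝ E] [MeasurableSpace E] [BorelSpace E] (V : Submodule ℝ E) {f : E → ℝ≥0∞}
    (hf : Measurable f) :
    ∫⁻ x, f x = ∫⁻ h : V, ∫⁻ k : Vᗮ, f (h + k) := by
  have hmp : MeasurePreserving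
      (fun z : V × Vᗮ => V.orthogonalDecomposition.symm (WithLp.toLp 2 z)) volume volume :=
    V.orthogonalDecomposition.symm.measurePreserving.comp (WithLp.volume_preserving_toLp V Vᗮ)
  rw [← hmp.lintegral_comp hf, Measure.volume_eq_prod]
  exact lintegral_prod _ (hf.comp hmp.measurable).aemeasurable

lemma hyperplaneVolume_eq (r : ℕ) : hyperplaneVolume r = volume :=
  (stdOrthonormalBasis ℝ (hyperplane r)).addHaar_eq_volume

lemma mem_hyperplane {r : ℕ} {a : EuclideanSpace ℝ (Fin (r + 1))} :
    a ∈ hyperplane r ↔ ∑ i, a i = 0 := Iff.rfl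

lemma apply_eq_of_mem_orthogonal {r : ℕ} {k : EuclideanSpace ℝ (Fin (r + 1))}
    (hk : k ∈ (hyperplane r)ᗮ) (i j : Fin (r + 1)) : k i = k j := by
  -- Orthogonality is tested against `e_i - e_j`.
  have hmem : EuclideanSpace.single i (1 : ℝ) - EuclideanSpace.single j (1 : ℝ) ∈ hyperplane r := by
    rw [mem_hyperplane]
    simp [Finset.sum_sub_distrib]
  have h := (Submodule.mem_orthogonal _ _).1 hk _ hmem
  rw [inner_sub_left, EuclideanSpace.inner_single_left, EuclideanSpace.inner_single_left] at h
  simp at h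
  linarith

lemma finrank_orthogonal_hyperplane (r : ℕ) : Module.finrank ℝ (hyperplane r)ᗮ = 1 := by
  let e : EuclideanSpace ℝ (Fin (r + 1)) := WithLp.toLp 2 fun _ => 1
  have he : e ∈ (hyperplane r)ᗮ := by
    rw [Submodule.mem_orthogonal]
    intro u hu
    rw [mem_hyperplane] at hu
    simpa [PiLp.inner_apply, e] using hu
  have hne : (⟨e, he⟩ : (hyperplane r)ᗮ) ≠ 0 := by
    intro h
    have := congrArg (fun k : (hyperplane r)ᗮ => (k : EuclideanSpace ℝ (Fin (r + 1))) 0) h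
    simp [e] at this
  refine (finrank_eq_one_iff_of_nonzero' _ hne).2 fun w => ⟨(w : EuclideanSpace ℝ (Fin (r + 1))) 0, ?_⟩
  ext i
  simpa [e] using apply_eq_of_mem_orthogonal w.2 0 i

lemma lintegral_gaussian {V : Type*} [NormedAddCommGroup V] [InnerProductSpace ℝ V]
    [FiniteDimensional ℝ V] [MeasurableSpace V] [BorelSpace V] {b : ℝ} (hb : 0 < b)
    (hV : Module.finrank ℝ V = 1) :
    ∫⁻ v : V, ENNReal.ofReal (Real.exp (-b * ‖v‖ ^ 2)) =
      ENNReal.ofReal (Real.exp (Real.log (Real.pi / b) / 2)) := by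
  have h := GaussianFourier.integral_rexp_neg_mul_sq_norm (V := V) hb
  have hpos : 0 < Real.pi / b := by positivity
  have hval : ∫ v : V, Real.exp (-b * ‖v‖ ^ 2) = Real.exp (Real.log (Real.pi / b) / 2) := by
    rw [h, hV, Real.rpow_def_of_pos hpos]; congr 1; push_cast; ring
  -- The integral of a non-integrable function is `0` by convention, so the nonzero value of the
  -- integral implies integrability.
  have hint : Integrable fun v : V => Real.exp (-b * ‖v‖ ^ 2) := by
    by_contra hni
    rw [integral_undef hni] at hval
    exact (Real.exp_pos _).ne hval
  rw [← hval, ofReal_integral_eq_lintegral_ofReal hint (ae_of_all _ fun v => (Real.exp_pos _).le)]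

/-- A vector orthogonal to the hyperplane has equal coordinates, so it does not change differences;
the Gaussian splits by Pythagoras. -/
lemma gaussWeight_mul_prodMinus_add {c σ β : ℝ} {r : ℕ} (h : hyperplane r) (k : (hyperplane r)ᗮ) :
    gaussWeight c σ (fun i => ((h : EuclideanSpace ℝ (Fin (r + 1))) + k) i) *
        prodMinus β (fun i => ((h : EuclideanSpace ℝ (Fin (r + 1))) + k) i) =
      gaussWeight c σ (fun i => h.1 i) * prodMinus β (fun i => h.1 i) *
        Real.exp (-(c / (2 * σ ^ 2)) * ‖k‖ ^ 2) := by
  have hP : prodMinus β (fun i => ((h : EuclideanSpace ℝ (Fin (r + 1))) + k) i) =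
      prodMinus β (fun i => h.1 i) := by
    unfold prodMinus
    refine Finset.prod_congr rfl fun i _ => Finset.prod_congr rfl fun j _ => ?_
    simp only
    rw [PiLp.add_apply, PiLp.add_apply, apply_eq_of_mem_orthogonal k.2 i j, add_sub_add_right_eq_sub]
  have hS : ∑ i, (((h : EuclideanSpace ℝ (Fin (r + 1))) + k) i) ^ 2 =
      ∑ i, (h.1 i) ^ 2 + ‖k‖ ^ 2 := by
    have e : ∀ v : EuclideanSpace ℝ (Fin (r + 1)), ∑ i, v i ^ 2 = ‖v‖ ^ 2 := fun v => by
      rw [EuclideanSpace.norm_sq_eq]; simp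
    have ho := norm_add_sq_eq_norm_sq_add_norm_sq_real
      ((Submodule.mem_orthogonal _ _).1 k.2 h.1 h.2)
    rw [e, e, sq, sq, sq, Submodule.coe_norm]
    exact ho
  rw [hP, gaussWeight, gaussWeight, hS, mul_add, Real.exp_add]
  ring

lemma ZA_eq (K : Coupling) (hq' : K.q' = 0) (hs : K.s = 0) {κ c σ : ℝ} (hκ : 0 < κ) {r : ℕ}
    (hc : c / (2 * σ ^ 2) = 2 * K.p * r) (hr : 0 < r) :
    ZA κ c (2 * K.q) r σ =
      ENNReal.ofReal (Real.exp (r * Real.log κ + K.shift * ((r + 1) * r : ℕ)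
        - Real.log (Real.pi / (2 * K.p * r)) / 2)) *
        K.partitionFn (oneBody 0 0 0) (r + 1) := by
  have hp := K.p_pos
  have hb : 0 < 2 * K.p * r := by positivity
  set G := Real.log (Real.pi / (2 * K.p * r)) / 2 with hG
  have hmeas : Measurable fun a : EuclideanSpace ℝ (Fin (r + 1)) =>
      ENNReal.ofReal (gaussWeight c σ (fun i => a i) * prodMinus (2 * K.q) (fun i => a i)) := by
    have := Real.continuous_sinh.measurable
    unfold gaussWeight prodMinus
    fun_prop
  have hfull : ENNReal.ofReal (Real.exp (K.shift * ((r + 1) * r : ℕ))) *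
      K.partitionFn (oneBody 0 0 0) (r + 1) =
      (∫⁻ a : hyperplane r, ENNReal.ofReal
        (gaussWeight c σ (fun i => a.1 i) * prodMinus (2 * K.q) (fun i => a.1 i))
          ∂(hyperplaneVolume r)) * ENNReal.ofReal (Real.exp G) := by
    have h := K.exp_mul_partitionFn 0 0 0 (r + 1)
    rw [Nat.add_sub_cancel] at h
    rw [h, hyperplaneVolume_eq]
    calc _ = ∫⁻ a : Fin (r + 1) → ℝ,
          ENNReal.ofReal (gaussWeight c σ a * prodMinus (2 * K.q) a) := by
          refine lintegral_congr fun a => ?_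
          rw [gaussWeight_eq_prod, hc, prodMinus, mul_comm]
          simp [Coupling.crossWeight, hq', hs]
      _ = ∫⁻ a : EuclideanSpace ℝ (Fin (r + 1)),
          ENNReal.ofReal (gaussWeight c σ (fun i => a i) * prodMinus (2 * K.q) (fun i => a i)) := by
          rw [← (PiLp.volume_preserving_toLp (Fin (r + 1))).lintegral_comp hmeas]
      _ = _ := by
          rw [lintegral_eq_lintegral_submodule (hyperplane r) hmeas,
            ← lintegral_mul_const' _ _ ENNReal.ofReal_ne_top]
          refine lintegral_congr fun x => ?_
          simp_rw [gaussWeight_mul_prodMinus_add, ENNReal.ofReal_mul' (Real.exp_pos _).le]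
          rw [lintegral_const_mul' _ _ (by finiteness), hc,
            lintegral_gaussian hb (finrank_orthogonal_hyperplane r)]
  rw [ZA, add_sub_right_comm, Real.exp_add, ENNReal.ofReal_mul (Real.exp_pos _).le, mul_assoc, hfull,
    sub_eq_add_neg, Real.exp_add, ENNReal.ofReal_mul (Real.exp_pos _).le, Real.exp_nat_mul,
    Real.exp_log hκ, mul_assoc, mul_left_comm (ENNReal.ofReal (Real.exp (-G))),
    ← ENNReal.ofReal_mul (Real.exp_pos _).le, ← Real.exp_add]
  simp

/-! ### The equilibrium energies -/

/-- The two-body weight attached to the parameters of a root system. -/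
noncomputable def rootCoupling {c t : ℝ} (hc : 0 < c) (ht : 0 < t) (q q' s : ℝ≥0) : Coupling where
  p := c / (4 * t)
  p_pos := by positivity
  q := q
  q' := q'
  s := s

section

variable {c t β : ℝ} (hc : 0 < c) (ht : 0 < t)

lemma eqA_eq {q : ℝ≥0} (hq : (q : ℝ) = β / 2) :
    eqA c t β = (((rootCoupling hc ht q 0 0).minEnergy.toReal -
      (rootCoupling hc ht q 0 0).shift : ℝ) : EReal) := by
  rw [← Coupling.iInf_totalEnergy_sub]
  refine iInf_congr fun μ => ?_
  rw [← Coupling.extIntegral_pairEnergy]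
  unfold energyA energy
  congr 1
  funext z
  rw [← Coupling.ereal_pairEnergy]
  have e : 2 * (rootCoupling hc ht q 0 0).p = c / (2 * t) := by
    simp only [rootCoupling]; field_simp; ring
  rw [e]
  simp [rootCoupling, hq]

lemma eqBC_eq {δ : ℝ} {q s : ℝ≥0} (hq : (q : ℝ) = β / 2) (hs : (s : ℝ) = β * (δ - 1) / 2) :
    eqBC c t β δ = (((rootCoupling hc ht q q s).minEnergy.toReal -
      (rootCoupling hc ht q q s).shift : ℝ) : EReal) := by
  rw [← Coupling.iInf_totalEnergy_sub]
  refine iInf_congr fun μ => ?_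
  rw [← Coupling.extIntegral_pairEnergy]
  unfold energyBC energy
  congr 1
  funext z
  rw [← Coupling.ereal_pairEnergy]
  have e : 2 * (rootCoupling hc ht q q s).p = c / (2 * t) := by
    simp only [rootCoupling]; field_simp; ring
  have e2 : 2 * ((rootCoupling hc ht q q s).s : ℝ) = β * (δ - 1) := by
    simp only [rootCoupling, hs]; ring
  rw [e, e2, ← hq, EReal.left_distrib_of_nonneg_of_ne_top (by simp) (EReal.coe_ne_top _)]
  rfl

/-- At `δ = 1` the term in `ell x` has coefficient zero, also at `x = 0`, since `0 * ⊥ = 0` in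
`EReal`. -/
lemma eqC_eq_eqBC : eqC c t β = eqBC c t β 1 := by
  simp [eqC, eqBC, energyC, energyBC]

end

/-! ### Asymptotics for the root systems -/

lemma tendsto_natCast_add_div (k : ℕ) :
    Tendsto (fun r : ℕ => ((r + k : ℕ) : ℝ) / r) atTop (𝓝 1) := by
  have h : Tendsto (fun r : ℕ => 1 + (k : ℝ) / r) atTop (𝓝 (1 + 0)) :=
    tendsto_const_nhds.add (tendsto_const_div_atTop_nhds_zero_nat _)
  rw [add_zero] at h
  refine h.congr' ?_
  filter_upwards [eventually_gt_atTop 0] with r hr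
  have : (r : ℝ) ≠ 0 := by positivity
  push_cast; field_simp

lemma tendsto_mul_div_sq (x : ℝ) :
    Tendsto (fun r : ℕ => r * x / (r : ℝ) ^ 2) atTop (𝓝 0) := by
  refine (tendsto_const_div_atTop_nhds_zero_nat x).congr' ?_
  filter_upwards [eventually_gt_atTop 0] with r hr
  have : (r : ℝ) ≠ 0 := by positivity
  field_simp

/-- Writing the exponent as `β (δ - 1) (r - 1) + α₀` treats both regimes at once: `α₀ = β (δ - 1)`
gives a multiplicity proportional to the rank, and `δ = 1` gives a fixed one. -/
lemma tendsto_ZBC {c t β κ : ℝ} (hc : 0 < c) (ht : 0 < t) (hβ : 0 < β) (hκ : 0 < κ) {σ : ℕ → ℝ}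
    (hσ : ∀ r : ℕ, 0 < r → 0 < σ r ∧ (r : ℝ) * σ r ^ 2 = t) {δ γ α₀ : ℝ} (hδ : 1 ≤ δ) (hγ : 0 ≤ γ)
    (hα₀ : 0 ≤ α₀) {α : ℕ → ℝ} (hα : ∀ r, 0 < r → α r = β * (δ - 1) * (r - 1 : ℕ) + α₀) :
    Tendsto (fun r : ℕ => scaledLog r (ZBC κ c β (α r) γ r (σ r))) atTop
      (𝓝 (-eqBC c t β δ)) := by
  lift γ to ℝ≥0 using hγ
  lift α₀ to ℝ≥0 using hα₀
  obtain ⟨q, hq⟩ : ∃ q : ℝ≥0, (q : ℝ) = β / 2 := ⟨⟨β / 2, by positivity⟩, rfl⟩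
  obtain ⟨s, hs⟩ : ∃ s : ℝ≥0, (s : ℝ) = β * (δ - 1) / 2 :=
    ⟨⟨β * (δ - 1) / 2, by have : 0 ≤ δ - 1 := by linarith
                          positivity⟩, rfl⟩
  -- The Gaussian exponent is `2 p r`, of which the pairs account for `2 p (r - 1)`; the remaining
  -- `2 p = c / (2 t)` goes into the one-body weight.
  obtain ⟨m, hm⟩ : ∃ m : ℝ≥0, (m : ℝ) = c / (2 * t) := ⟨⟨c / (2 * t), by positivity⟩, rfl⟩
  set K := rootCoupling hc ht q q s with hK
  rw [eqBC_eq hc ht hq hs, ← EReal.coe_neg, neg_sub]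
  refine K.tendsto_scaledLog (m := m) (α := α₀) (γ := γ) (n := fun r => r)
    (u := fun r => r * Real.log κ + K.shift * (r * (r - 1) : ℕ)) ?_ ?_ ?_ tendsto_id
  · filter_upwards [eventually_gt_atTop 0] with r hr
    obtain ⟨h0, h1⟩ := hσ r hr
    have e : β = 2 * K.q := by simp only [hK, rootCoupling, hq]; ring
    rw [e]
    refine ZBC_eq K rfl hκ ?_ ?_
    · have hr' : ((r - 1 : ℕ) : ℝ) = r - 1 := by rw [Nat.cast_sub hr]; simp
      simp only [hK, rootCoupling]
      rw [hr', hm, ← h1]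
      have : (r : ℝ) ≠ 0 := by positivity
      field_simp; ring
    · rw [hα r hr]; simp only [hK, rootCoupling, hs]; ring
  · have h1 := (tendsto_mul_div_sq (Real.log κ)).add ((tendsto_natCast_add_div 0).const_mul K.shift)
    have h2 := h1.sub (tendsto_mul_div_sq K.shift)
    rw [zero_add, mul_one, sub_zero] at h2
    refine h2.congr' ?_
    filter_upwards [eventually_gt_atTop 0] with r hr
    have : (r : ℝ) ≠ 0 := by positivity
    have hr' : ((r - 1 : ℕ) : ℝ) = r - 1 := by rw [Nat.cast_sub hr]; simp
    rw [Nat.cast_mul, hr', add_zero]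
    field_simp; ring
  · exact tendsto_natCast_add_div 0

lemma tendsto_log_div_sq {x : ℝ} (hx : 0 < x) :
    Tendsto (fun r : ℕ => Real.log (Real.pi / (x * r)) / 2 / (r : ℝ) ^ 2) atTop (𝓝 0) := by
  have h1 : Tendsto (fun r : ℕ => Real.log r / (r : ℝ) ^ 1) atTop (𝓝 0) := by
    simpa [Function.comp_def] using
      Real.isLittleO_log_id_atTop.tendsto_div_nhds_zero.comp tendsto_natCast_atTop_atTop
  have h2 := (tendsto_const_div_atTop_nhds_zero_nat (Real.log (Real.pi / x) / 2)).sub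
    (h1.div_const 2)
  have h3 := h2.mul tendsto_one_div_atTop_nhds_zero_nat
  rw [mul_zero] at h3
  refine h3.congr' ?_
  filter_upwards [eventually_gt_atTop 0] with r hr
  have hr' : (r : ℝ) ≠ 0 := by positivity
  rw [← div_div, Real.log_div (by positivity) hr']
  field_simp

lemma tendsto_ZA {c t β κ : ℝ} (hc : 0 < c) (ht : 0 < t) (hβ : 0 < β) (hκ : 0 < κ) {σ : ℕ → ℝ}
    (hσ : ∀ r : ℕ, 0 < r → 0 < σ r ∧ (r : ℝ) * σ r ^ 2 = t) :
    Tendsto (fun r : ℕ => scaledLog r (ZA κ c β r (σ r))) atTop (𝓝 (-eqA c t β)) := by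
  obtain ⟨q, hq⟩ : ∃ q : ℝ≥0, (q : ℝ) = β / 2 := ⟨⟨β / 2, by positivity⟩, rfl⟩
  set K := rootCoupling hc ht q 0 0 with hK
  have hp := K.p_pos
  rw [eqA_eq hc ht hq, ← EReal.coe_neg, neg_sub]
  -- There are `r + 1` points, each in `r` pairs, so the pairs account for the whole Gaussian
  -- exponent `2 p r` and no one-body weight is left.
  refine K.tendsto_scaledLog (m := 0) (α := 0) (γ := 0) (n := fun r => r + 1)
    (u := fun r => r * Real.log κ + K.shift * ((r + 1) * r : ℕ)
      - Real.log (Real.pi / (2 * K.p * r)) / 2) ?_ ?_ (tendsto_natCast_add_div 1)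
    (tendsto_add_atTop_nat 1)
  · filter_upwards [eventually_gt_atTop 0] with r hr
    obtain ⟨h0, h1⟩ := hσ r hr
    have e : β = 2 * K.q := by simp only [hK, rootCoupling, hq]; ring
    rw [e]
    refine ZA_eq K rfl rfl hκ ?_ hr
    simp only [hK, rootCoupling]
    rw [← h1]
    have : (r : ℝ) ≠ 0 := by positivity
    field_simp; ring
  · have h1 := (tendsto_mul_div_sq (Real.log κ)).add ((tendsto_natCast_add_div 1).const_mul K.shift)
    have h2 := h1.sub (tendsto_log_div_sq (show 0 < 2 * K.p by positivity))
    rw [zero_add, mul_one, sub_zero] at h2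
    refine h2.congr' ?_
    filter_upwards [eventually_gt_atTop 0] with r hr
    have : (r : ℝ) ≠ 0 := by positivity
    rw [Nat.cast_mul]
    field_simp

end LogSinh

/-! ### The theorem for all root systems -/

open LogSinh

theorem proposition4 (c t β κ : ℝ) (hc : 0 < c) (ht : 0 < t) (hβ : 0 < β) (hκ : 0 < κ)
    (σ : ℕ → ℝ) (hσ : ∀ r : ℕ, 0 < r → 0 < σ r ∧ (r : ℝ) * σ r ^ 2 = t) :
    -- the equilibrium energies are finite
    ((LogSinh.eqA c t β ≠ ⊥ ∧ LogSinh.eqA c t β ≠ ⊤) ∧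
      (LogSinh.eqC c t β ≠ ⊥ ∧ LogSinh.eqC c t β ≠ ⊤) ∧
      (∀ δ : ℝ, 1 ≤ δ → LogSinh.eqBC c t β δ ≠ ⊥ ∧ LogSinh.eqBC c t β δ ≠ ⊤)) ∧
    -- root systems of type A
    Tendsto (fun r : ℕ => LogSinh.scaledLog r (LogSinh.ZA κ c β r (σ r))) atTop
      (𝓝 (-LogSinh.eqA c t β)) ∧
    -- root systems of type B
    (∀ δ : ℝ, 1 ≤ δ →
      Tendsto (fun r : ℕ =>
          LogSinh.scaledLog r (LogSinh.ZB κ c β (β * (δ - 1) * r) r (σ r))) atTop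
        (𝓝 (-LogSinh.eqBC c t β δ))) ∧
    -- root systems of type C
    (∀ γ : ℝ, 0 ≤ γ →
      Tendsto (fun r : ℕ => LogSinh.scaledLog r (LogSinh.ZC κ c β γ r (σ r))) atTop
        (𝓝 (-LogSinh.eqC c t β))) ∧
    -- root systems of type D
    Tendsto (fun r : ℕ => LogSinh.scaledLog r (LogSinh.ZD κ c β r (σ r))) atTop
      (𝓝 (-LogSinh.eqC c t β)) ∧
    -- root systems of type BC, short roots with a multiplicity proportional to the rank
    (∀ δ γ : ℝ, 1 ≤ δ → 0 ≤ γ →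
      Tendsto (fun r : ℕ =>
          LogSinh.scaledLog r (LogSinh.ZBC κ c β (β * (δ - 1) * r) γ r (σ r))) atTop
        (𝓝 (-LogSinh.eqBC c t β δ))) ∧
    -- root systems of type BC, short roots with a multiplicity that does not depend on the rank
    (∀ α γ : ℝ, 0 ≤ α → 0 ≤ γ →
      Tendsto (fun r : ℕ => LogSinh.scaledLog r (LogSinh.ZBC κ c β α γ r (σ r))) atTop
        (𝓝 (-LogSinh.eqC c t β))) := by
  obtain ⟨q, hq⟩ : ∃ q : NNReal, (q : ℝ) = β / 2 := ⟨⟨β / 2, by positivity⟩, rfl⟩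
  have hBC : ∀ δ : ℝ, 1 ≤ δ → eqBC c t β δ ≠ ⊥ ∧ eqBC c t β δ ≠ ⊤ := fun δ hδ => by
    obtain ⟨s, hs⟩ : ∃ s : NNReal, (s : ℝ) = β * (δ - 1) / 2 :=
      ⟨⟨β * (δ - 1) / 2, by have : 0 ≤ δ - 1 := by linarith
                            positivity⟩, rfl⟩
    rw [eqBC_eq hc ht hq hs]
    exact ⟨EReal.coe_ne_bot _, EReal.coe_ne_top _⟩
  have hprop : ∀ δ γ : ℝ, 1 ≤ δ → 0 ≤ γ →
      Tendsto (fun r : ℕ => scaledLog r (ZBC κ c β (β * (δ - 1) * r) γ r (σ r))) atTop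
        (𝓝 (-eqBC c t β δ)) := fun δ γ hδ hγ => by
    have hα₀ : 0 ≤ β * (δ - 1) := mul_nonneg hβ.le (by linarith)
    refine tendsto_ZBC hc ht hβ hκ hσ hδ hγ hα₀ fun r hr => ?_
    rw [Nat.cast_sub hr]; push_cast; ring
  have hfix : ∀ α γ : ℝ, 0 ≤ α → 0 ≤ γ →
      Tendsto (fun r : ℕ => scaledLog r (ZBC κ c β α γ r (σ r))) atTop
        (𝓝 (-eqC c t β)) := fun α γ hα hγ => by
    rw [eqC_eq_eqBC]
    exact tendsto_ZBC hc ht hβ hκ hσ le_rfl hγ hα fun r hr => by simp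
  refine ⟨⟨?_, ?_, hBC⟩, tendsto_ZA hc ht hβ hκ hσ, fun δ hδ => ?_, fun γ hγ => ?_, ?_, hprop, hfix⟩
  · rw [eqA_eq hc ht hq]
    exact ⟨EReal.coe_ne_bot _, EReal.coe_ne_top _⟩
  · rw [eqC_eq_eqBC]
    exact hBC 1 le_rfl
  · simp_rw [ZB_eq]
    exact hprop δ 0 hδ le_rfl
  · simp_rw [ZC_eq]
    exact hfix 0 γ le_rfl hγ
  · simp_rw [ZD_eq]
    exact hfix 0 0 le_rfl le_rfl
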